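/- Let $\mathbb T$ be the unit circle with normalized arclength measure $\mu$, let $\chi(z)=z$, and let $H^2\subset L^2(\mathbb T)$ be the Hardy space, whose elements are identified with their analytic extensions to the unit disc $\mathbb D$. A function $f\in H^2$ is called outer if its polynomial multiples are dense in $H^2$. For a subspace $\mathcal V\subset \mathbb C\oplus\mathbb C z$ put $H^2_{\mathcal V}=H^2\ominus\mathcal V$, and for a real-valued $\phi\in L^\infty(\mathbb T)$ let $T^{\mathcal V}_\phi f=P_{\mathcal V}(\phi f)$ on $H^2_{\mathcal V}$, where $P_{\mathcal V}$ is the orthogonal projection of $L^2(\mathbb T)$ onto $H^2_{\mathcal V}$. Let $\phi\in L^\infty(\mathbb T)$ be real-valued and let $c\in\mathbb C\setminus\{0\}$ be such that $$\operatorname{ess\,sup}\{\phi(z): cz+\overline{cz}<0\}=m<0<M=\operatorname{ess\,inf}\{\phi(z): cz+\overline{cz}>0\}.$$ Let $\lambda\in(m,M)$ and, for $z\in\mathbb D$ and $t\in\mathbb R$, put $H(z,t)=\frac{e^{it}+z}{e^{it}-z}$, $$h_c(z)=\exp\Bigl(\frac1{2\pi}\int_{-\pi}^{\pi}H(z,t)\log|ce^{it}+\bar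 c e^{-it}|^{1/2}\,dt\Bigr),\qquad g_\lambda(z)=\exp\Bigl(\frac1{2\pi}\int_{-\pi}^{\pi}H(z,t)\log|\phi(e^{it})-\lambda|^{-1/2}\,dt\Bigr).$$ Then: 1. $h_c$ and $g_\lambda$ are outer functions in $H^2$, and $h_c(0)\neq0$, $g_\lambda(0)\neq 0$. 2. There is an outer function $f_\lambda\in H^2$ with $(\phi-\lambda)|f_\lambda|^2=c\chi+\overline{c\chi}$ a.e. on $\mathbb T$ and $f_\lambda=h_c\,g_\lambda$ on $\mathbb D$; every outer function satisfying the same equation on $\mathbb T$ is a unimodular constant multiple of $f_\lambda$. 3. There is a subspace $\mathcal V\subset\mathbb C\oplus\mathbb C z$, with $\mathcal V\ne\{0\}$ and $\mathcal V\neq\mathbb C\oplus\mathbb C z$, orthogonal to $$h_c(0)g_\lambda(0)+\bigl(h_c(0)g_\lambda'(0)+h_c'(0)g_\lambda(0)\bigr)z,$$ such that $f_\lambda\in H^2_{\mathcal V}$ and $T^{\mathcal V}_\phi f_\lambda=\lambda f_\lambda$. It is the only nonzero subspace $\mathcal W\subset\mathbb C\oplus\mathbb C z$ with $f_\lambda\in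 H^2_{\mathcal W}$. Moreover, if $\mathcal W\subset\mathbb C\oplus\mathbb C z$ is any subspace and $f\in H^2_{\mathcal W}$ is nonzero with $T^{\mathcal W}_\phi f=\lambda f$, then $\mathcal W=\mathcal V$ and $f$ is a nonzero scalar multiple of $f_\lambda$. -/

import Mathlib

open MeasureTheory AddCircle
open scoped ENNReal

noncomputable section

namespace NeilToeplitz

instance fact_two_pi_pos : Fact (0 < 2 * Real.pi) := ⟨Real.two_pi_pos⟩

/-- The unit circle, parametrised by the angle `t` modulo `2π`. The coordinate function
`χ(e^{it}) = e^{it}` is `fourier 1`. -/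
abbrev Torus : Type := AddCircle (2 * Real.pi)

/-- Normalised arclength measure on the unit circle. -/
abbrev arc : Measure Torus := haarAddCircle

/-- `L²` of the circle with respect to normalised arclength. -/
abbrev L2 : Type := Lp ℂ 2 arc

/-- The Hardy space `H²`, as the space of boundary functions: those `f ∈ L²` whose Fourier
coefficients of negative index vanish. -/
def H2 : Submodule ℂ L2 where
  carrier := {f | ∀ n : ℤ, n < 0 → fourierCoeff f n = 0}
  add_mem' := by
    intro f g hf hg n hn
    have hf' := hf n hn
    have hg' := hg n hn
    rw [← fourierBasis_repr] at hf' hg' ⊢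
    simp [hf', hg']
  zero_mem' := by
    intro n _
    rw [← fourierBasis_repr]
    simp
  smul_mem' := by
    intro a f hf n hn
    have hf' := hf n hn
    rw [← fourierBasis_repr] at hf' ⊢
    simp [hf']

theorem mem_H2 (f : L2) : f ∈ H2 ↔ ∀ n : ℤ, n < 0 → fourierCoeff f n = 0 := Iff.rfl

theorem isClosed_H2 : IsClosed (H2 : Set L2) := by
  have h : (H2 : Set L2) =
      ⋂ (n : ℤ) (_ : n < 0), {f : L2 | inner ℂ (fourierBasis n : L2) f = 0} := by
    ext f
    simp only [SetLike.mem_coe, mem_H2, Set.mem_iInter, Set.mem_ofPred_eq,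
      ← HilbertBasis.repr_apply_apply, fourierBasis_repr]
  rw [h]
  refine isClosed_iInter fun n => isClosed_iInter fun _ => ?_
  exact isClosed_eq (continuous_const.inner continuous_id) continuous_const

/-- The value at a point `z` of the unit disc of the analytic function with boundary function
`f ∈ H²`, i.e. `∑ n ≥ 0, f^(n) z ^ n`. -/
def eval (f : L2) (z : ℂ) : ℂ := ∑' n : ℕ, fourierCoeff f (n : ℤ) * z ^ n

/-- Multiplication by a (class of a) bounded function, as a bounded operator on `L²`. -/
def mulL (u : Lp ℂ ∞ arc) : L2 →L[ℂ] L2 :=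
  (ContinuousLinearMap.mul ℂ ℂ).holderL arc ∞ 2 2 u

/-- `f` is an outer function in `H²`: the polynomial multiples of `f` are dense in `H²`. -/
def IsOuter (f : L2) : Prop :=
  (Submodule.span ℂ (Set.range fun n : ℕ => mulL (fourierLp ∞ (n : ℤ)) f)).topologicalClosure = H2

/-- A function on the disc is outer (in `H²`) if it is the analytic extension of an outer
`f ∈ H²`. -/
def IsOuterOnDisc (F : ℂ → ℂ) : Prop :=
  ∃ f : L2, IsOuter f ∧ ∀ z ∈ Metric.ball (0 : ℂ) 1, F z = eval f z

/-- The constant function `1` in `L²`. -/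
def one : L2 := fourierLp 2 0

/-- The coordinate function `χ(z) = z` in `L²`. -/
def chi : L2 := fourierLp 2 1

/-- The two-dimensional space `ℂ ⊕ ℂ z`. -/
def linPoly : Submodule ℂ L2 := Submodule.span ℂ {one, chi}

/-- `H²_𝒱 = H² ⊖ 𝒱`. -/
def H2V (V : Submodule ℂ L2) : Submodule ℂ L2 := H2 ⊓ Vᗮ

instance completeSpace_H2V (V : Submodule ℂ L2) : CompleteSpace (H2V V) := by
  have h : IsClosed (H2V V : Set L2) := by
    have := isClosed_H2.inter V.isClosed_orthogonal
    simpa [H2V] using this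
  exact h.completeSpace_coe

/-- The Toeplitz operator `T_φ^𝒱 f = P_𝒱 (φ f)` on `H²_𝒱`, for a real symbol `φ ∈ L^∞`;
`P_𝒱` is the orthogonal projection of `L²` onto `H²_𝒱`. -/
def toeplitz (φ : Torus → ℝ) (hφ : MemLp φ ∞ arc) (V : Submodule ℂ L2) :
    H2V V →L[ℂ] H2V V :=
  (H2V V).orthogonalProjectionOnto ∘L
    mulL (MemLp.toLp (fun t => (φ t : ℂ)) hφ.ofReal) ∘L (H2V V).subtypeL

/-- The real-valued function `cχ + (cχ)^* = 2 Re (cχ)` on the circle. -/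
def trig (c : ℂ) (t : Torus) : ℝ := 2 * (c * fourier 1 t).re

/-- The Herglotz kernel `H(z,t) = (e^{it} + z) / (e^{it} - z)`. -/
def herglotz (z : ℂ) (t : ℝ) : ℂ :=
  (Complex.exp (Complex.I * t) + z) / (Complex.exp (Complex.I * t) - z)

/-- `h_c(z) = exp ((1/2π) ∫_{-π}^{π} H(z,t) log |c e^{it} + c^* e^{-it}|^{1/2} dt)`. -/
def hFun (c : ℂ) (z : ℂ) : ℂ :=
  Complex.exp ((1 / (2 * Real.pi) : ℂ) * ∫ t in (-Real.pi)..Real.pi, herglotz z t *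
    (Real.log (‖c * Complex.exp (Complex.I * t) +
      (starRingEnd ℂ) c * Complex.exp (-(Complex.I * t))‖ ^ (1 / 2 : ℝ)) : ℂ))

/-- `g_l(z) = exp ((1/2π) ∫_{-π}^{π} H(z,t) log |φ(t) - l|^{-1/2} dt)`. -/
def gFun (φ : Torus → ℝ) (l : ℝ) (z : ℂ) : ℂ :=
  Complex.exp ((1 / (2 * Real.pi) : ℂ) * ∫ t in (-Real.pi)..Real.pi, herglotz z t *
    (Real.log (|φ (t : Torus) - l| ^ (-1 / 2 : ℝ)) : ℂ))

end NeilToeplitz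

end

noncomputable section

namespace NeilToeplitz

open Filter Topology ComplexConjugate

/-! Write τ = cχ + conj(cχ). The sign hypothesis makes φ − λ bounded, bounded away from 0, and of
the same sign as τ (`symbol_bounds`), so the equation for f only prescribes |f|² = τ/(φ − λ), whose
logarithm lies in L².

Outer functions are built from their log-modulus. For real U ∈ L² bounded above, let A U be
`analyticCompletion U`, which lies in H² and has real part U. Then exp(A U) is outer
(`isOuter_exp_analyticCompletion`) and its extension to the disc is the exponential of the Herglotz
integral of U. Since A is linear, f = exp(A(Uh + Ug)) with Uh = ½ log|τ| and Ug = −½ log|φ − λ|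
factors as h_c g_λ. Outer functions of equal modulus, nonzero a.e., differ by a unimodular constant
(`IsOuter.eq_smul_of_norm_eq`).

T g = λg on H²_W means that D = (φ − λ)g is orthogonal to H²_W. Testing against g and against χⁿg, n
≥ 2, kills the Fourier coefficients of index 0 and n ≥ 2 of the real function (φ − λ)|g|². Hence
this function is dχ + conj(dχ), and its sign forces d = rc with r > 0, so |g| = √r |f|. To exclude
an inner factor u = g/(√r f), note that uf ∈ H², while D has no coefficients of index ≥ 2, so that χ
conj D ∈ H². Up to √r the latter is conj(u) X with X = χ(φ − λ) conj f. The product fX = χτ = cz² +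
conj c is outer (`isOuter_quadratic`), which makes X outer too. Thus u and conj u both lie in H²,
and u is constant (`ae_eq_const_of_mulL_mem`).

The space V consists of the vectors of ℂ ⊕ ℂz orthogonal to f; it is a line because f(0) ≠ 0. For f
itself, outerness shows that the projection of (φ − λ)f to H² lies in ℂ ⊕ ℂz, and it is orthogonal
to f because τ has mean zero. So it lies in V, which is the eigenvalue equation. -/

/-! ### Fourier coefficients, multiplication operators, convergence in L² -/

theorem fourierCoeff_eq_inner (f : L2) (n : ℤ) :
    fourierCoeff f n = inner ℂ (fourierLp 2 n : L2) f := by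
  rw [← fourierBasis_repr, HilbertBasis.repr_apply_apply, coe_fourierBasis]

theorem ext_fourierCoeff {f g : L2} (h : ∀ n, fourierCoeff f n = fourierCoeff g n) : f = g := by
  apply fourierBasis.repr.injective
  ext n
  simpa [fourierBasis_repr] using h n

theorem fourierCoeff_add' (f g : L2) (n : ℤ) :
    fourierCoeff (f + g : L2) n = fourierCoeff f n + fourierCoeff g n := by
  simp only [fourierCoeff_eq_inner, inner_add_right]

theorem fourierCoeff_sub' (f g : L2) (n : ℤ) :
    fourierCoeff (f - g : L2) n = fourierCoeff f n - fourierCoeff g n := by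
  simp only [fourierCoeff_eq_inner, inner_sub_right]

theorem fourierCoeff_smul' (a : ℂ) (f : L2) (n : ℤ) :
    fourierCoeff (a • f : L2) n = a * fourierCoeff f n := by
  simp only [fourierCoeff_eq_inner, inner_smul_right]

theorem fourierCoeff_fourierLp (k n : ℤ) :
    fourierCoeff (fourierLp 2 k : L2) n = if n = k then 1 else 0 := by
  rw [fourierCoeff_eq_inner]
  exact orthonormal_iff_ite.1 orthonormal_fourier n k

theorem coeFn_mulL (u : Lp ℂ ∞ arc) (f : L2) : mulL u f =ᵐ[arc] fun t => u t * f t := by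
  exact (ContinuousLinearMap.mul ℂ ℂ).coeFn_holder (r := 2) u f

theorem coeFn_mulL_fourierLp (n : ℤ) (f : L2) :
    mulL (fourierLp ∞ n) f =ᵐ[arc] fun t => fourier n t * f t := by
  filter_upwards [coeFn_mulL (fourierLp ∞ n) f, coeFn_fourierLp (T := 2 * Real.pi) ∞ n] with t h1 h2
  rw [h1, h2]

theorem fourierCoeff_mulL_fourierLp (k : ℤ) (f : L2) (n : ℤ) :
    fourierCoeff (mulL (fourierLp ∞ k) f) n = fourierCoeff f (n - k) := by
  rw [fourierCoeff_congr_ae (coeFn_mulL_fourierLp k f)]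
  unfold fourierCoeff
  congr 1
  ext t
  rw [smul_eq_mul, smul_eq_mul, ← mul_assoc, ← fourier_add]
  congr 3
  ring

theorem fourierCoeff_star (f : L2) (n : ℤ) :
    fourierCoeff (star f : L2) n = conj (fourierCoeff f (-n)) := by
  rw [fourierCoeff_congr_ae (Lp.coeFn_star f)]
  unfold fourierCoeff
  rw [← integral_conj]
  congr 1
  ext t
  simp

theorem fourierLp_mem_H2 (n : ℕ) : (fourierLp 2 (n : ℤ) : L2) ∈ H2 := by
  intro k hk
  rw [fourierCoeff_fourierLp, if_neg (by omega)]

theorem mulL_fourierLp_mem_H2 (n : ℕ) {f : L2} (hf : f ∈ H2) :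
    mulL (fourierLp ∞ (n : ℤ)) f ∈ H2 := by
  intro k hk
  rw [fourierCoeff_mulL_fourierLp]
  exact hf _ (by omega)

theorem memLp_of_bound_mul {f g : Torus → ℂ} (hf : MemLp f 2 arc) (hg : AEStronglyMeasurable g arc)
    (B : ℝ) (hB : ∀ᵐ t ∂arc, ‖g t‖ ≤ B) : MemLp (fun t => g t * f t) 2 arc :=
  hf.of_le_mul (c := B) (hg.mul hf.1) <| by
    filter_upwards [hB] with t ht
    rw [norm_mul]
    gcongr

theorem norm_sq_eq_integral (f : L2) : ‖f‖ ^ 2 = ∫ t, ‖f t‖ ^ 2 ∂arc := by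
  have h := inner_self_eq_norm_sq_to_K (𝕜 := ℂ) f
  rw [L2.inner_def] at h
  have h2 : ∀ t, inner ℂ (f t) (f t) = ((‖f t‖ ^ 2 : ℝ) : ℂ) := fun t => by
    rw [inner_self_eq_norm_sq_to_K]; norm_cast
  simp_rw [h2] at h
  rw [integral_complex_ofReal] at h
  exact Complex.ofReal_injective (by simpa using h.symm)

/-- Dominated convergence in `L²`. -/
theorem tendsto_of_dominated {f : ℕ → L2} {g : L2} {b : Torus → ℝ} (hb : MemLp b 2 arc)
    (hfb : ∀ n, ∀ᵐ t ∂arc, ‖f n t‖ ≤ b t)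
    (h : ∀ᵐ t ∂arc, Tendsto (fun n => f n t) atTop (𝓝 (g t))) : Tendsto f atTop (𝓝 g) := by
  rw [tendsto_iff_norm_sub_tendsto_zero]
  have hgb : ∀ᵐ t ∂arc, ‖g t‖ ≤ b t := by
    filter_upwards [ae_all_iff.2 hfb, h] with t h1 h2
    exact le_of_tendsto h2.norm (Eventually.of_forall h1)
  have key : Tendsto (fun n => ∫ t, ‖(f n - g : L2) t‖ ^ 2 ∂arc) atTop
      (𝓝 (∫ _, (0 : ℝ) ∂arc)) := by
    refine tendsto_integral_of_dominated_convergence (fun t => (2 * b t) ^ 2) ?_ ?_ ?_ ?_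
    · exact fun n => ((Lp.aestronglyMeasurable _).norm.pow 2)
    · exact (hb.const_mul 2).integrable_sq
    · intro n
      filter_upwards [hfb n, hgb, Lp.coeFn_sub (f n) g] with t h1 h2 h3
      rw [h3, Real.norm_of_nonneg (by positivity), Pi.sub_apply]
      gcongr
      linarith [norm_sub_le (f n t) (g t)]
    · filter_upwards [ae_all_iff.2 fun n => Lp.coeFn_sub (f n) g, h] with t h3 h4
      simp only [h3, Pi.sub_apply]
      have := ((tendsto_iff_norm_sub_tendsto_zero.1 h4).pow 2)
      simpa using this
  simp only [integral_zero, ← norm_sq_eq_integral] at key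
  have := key.sqrt
  simpa [Real.sqrt_sq] using this

/-! ### Shift-invariant subspaces generated by one function -/

/-- The closed shift-invariant subspace generated by `f`. -/
def cyclic (f : L2) : Submodule ℂ L2 :=
  (Submodule.span ℂ (Set.range fun n : ℕ => mulL (fourierLp ∞ (n : ℤ)) f)).topologicalClosure

theorem isClosed_cyclic (f : L2) : IsClosed (cyclic f : Set L2) :=
  Submodule.isClosed_topologicalClosure _

theorem mulL_mem_cyclic (f : L2) (n : ℕ) : mulL (fourierLp ∞ (n : ℤ)) f ∈ cyclic f :=
  Submodule.le_topologicalClosure _ (Submodule.subset_span ⟨n, rfl⟩)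

theorem mulL_fourierLp_zero (f : L2) : mulL (fourierLp ∞ (0 : ℤ)) f = f :=
  ext_fourierCoeff fun n => by simp [fourierCoeff_mulL_fourierLp]

theorem mem_cyclic_self (f : L2) : f ∈ cyclic f := by
  simpa [mulL_fourierLp_zero] using mulL_mem_cyclic f 0

/-- A bounded operator mapping all `χ ^ n f` into a closed subspace maps `cyclic f` into it. -/
theorem map_mem_of_mem_cyclic {f : L2} {S : Submodule ℂ L2} (hS : IsClosed (S : Set L2))
    (Θ : L2 →L[ℂ] L2) (h : ∀ n : ℕ, Θ (mulL (fourierLp ∞ (n : ℤ)) f) ∈ S) {g : L2}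
    (hg : g ∈ cyclic f) : Θ g ∈ S := by
  have : cyclic f ≤ S.comap (Θ : L2 →ₗ[ℂ] L2) := by
    refine Submodule.topologicalClosure_minimal _ ?_ (hS.preimage Θ.continuous)
    rw [Submodule.span_le]
    rintro _ ⟨n, rfl⟩
    exact h n
  exact this hg

theorem cyclic_le {f : L2} {S : Submodule ℂ L2} (hS : IsClosed (S : Set L2))
    (h : ∀ n : ℕ, mulL (fourierLp ∞ (n : ℤ)) f ∈ S) : cyclic f ≤ S := fun _ hg =>
  map_mem_of_mem_cyclic hS (ContinuousLinearMap.id ℂ L2) h hg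

theorem mulL_mulL_fourierLp (m n : ℤ) (f : L2) :
    mulL (fourierLp ∞ m) (mulL (fourierLp ∞ n) f) = mulL (fourierLp ∞ (m + n)) f :=
  ext_fourierCoeff fun k => by
    simp only [fourierCoeff_mulL_fourierLp]
    congr 1
    ring

theorem mulL_mem_cyclic_of_mem {f g : L2} (hg : g ∈ cyclic f) (n : ℕ) :
    mulL (fourierLp ∞ (n : ℤ)) g ∈ cyclic f :=
  map_mem_of_mem_cyclic (isClosed_cyclic f) _ (fun m => by
    rw [mulL_mulL_fourierLp]
    exact mulL_mem_cyclic f (n + m)) hg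

theorem cyclic_le_cyclic {f g : L2} (h : g ∈ cyclic f) : cyclic g ≤ cyclic f :=
  cyclic_le (isClosed_cyclic f) fun n => mulL_mem_cyclic_of_mem h n

theorem cyclic_le_H2 {f : L2} (hf : f ∈ H2) : cyclic f ≤ H2 :=
  cyclic_le isClosed_H2 fun n => mulL_fourierLp_mem_H2 n hf

theorem mulL_fourierLp_one (n : ℤ) : mulL (fourierLp ∞ n) one = (fourierLp 2 n : L2) :=
  ext_fourierCoeff fun k => by
    rw [fourierCoeff_mulL_fourierLp, one, fourierCoeff_fourierLp, fourierCoeff_fourierLp]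
    simp only [sub_eq_zero]

/-- The constant function `1` is outer. -/
theorem isOuter_one : IsOuter one := by
  refine le_antisymm (cyclic_le_H2 (fourierLp_mem_H2 0)) fun f hf => ?_
  refine (isClosed_cyclic one).mem_of_tendsto (hasSum_fourier_series_L2 f)
    (Eventually.of_forall fun s => Submodule.sum_mem _ fun n _ => ?_)
  rcases lt_or_ge n 0 with hn | hn
  · rw [hf n hn, zero_smul]
    exact Submodule.zero_mem _
  · lift n to ℕ using hn
    refine Submodule.smul_mem _ _ ?_
    rw [← mulL_fourierLp_one]
    exact mulL_mem_cyclic one n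

theorem IsOuter.mem_H2 {f : L2} (hf : IsOuter f) : f ∈ H2 := hf ▸ mem_cyclic_self f

/-- Cyclicity is transitive and 1 is outer, so approximating the single function 1 is enough. -/
theorem isOuter_of_one_mem {f : L2} (hf : f ∈ H2) (h : one ∈ cyclic f) : IsOuter f :=
  le_antisymm (cyclic_le_H2 hf) (isOuter_one.ge.trans (cyclic_le_cyclic h))

/-! ### Completing a real function to an analytic one -/

instance completeSpace_H2 : CompleteSpace H2 := isClosed_H2.completeSpace_coe

/-- The operator `U ↦ 2 P U - ⟨1, U⟩` with `P` the Riesz projection onto `H²`. For real `U` it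
gives the boundary function of the Herglotz integral of `U`, and has real part `U`. -/
def analyticCompletion : L2 →L[ℂ] L2 :=
  (2 : ℂ) • H2.starProjection - (innerSL ℂ one).smulRight one

theorem fourierCoeff_starProjection_H2 (U : L2) (n : ℕ) :
    fourierCoeff (H2.starProjection U) n = fourierCoeff U n := by
  rw [fourierCoeff_eq_inner, fourierCoeff_eq_inner, ← Submodule.inner_starProjection_left_eq_right,
    Submodule.starProjection_eq_self_iff.2 (fourierLp_mem_H2 n)]

theorem analyticCompletion_apply (U : L2) :
    analyticCompletion U = (2 : ℂ) • H2.starProjection U - fourierCoeff U 0 • one := by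
  rw [fourierCoeff_eq_inner]
  rfl

theorem analyticCompletion_mem_H2 (U : L2) : analyticCompletion U ∈ H2 := by
  rw [analyticCompletion_apply]
  exact H2.sub_mem (H2.smul_mem _ (Submodule.starProjection_apply_mem _ _))
    (H2.smul_mem _ (fourierLp_mem_H2 0))

theorem fourierCoeff_analyticCompletion (U : L2) (n : ℕ) :
    fourierCoeff (analyticCompletion U) n = (if n = 0 then 1 else 2) * fourierCoeff U n := by
  rw [analyticCompletion_apply, fourierCoeff_sub', fourierCoeff_smul', fourierCoeff_smul',
    fourierCoeff_starProjection_H2, one, fourierCoeff_fourierLp]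
  rcases eq_or_ne n 0 with rfl | hn
  · simp
    ring
  · simp [hn]

/-- Coefficients of a real U satisfy Û(−n) = conj Û(n). Adding the conjugate of the completion
therefore restores the negative frequencies and gives 2U. -/
theorem re_analyticCompletion {U : L2} (hU : ∀ᵐ t ∂arc, (U t).im = 0) :
    ∀ᵐ t ∂arc, (analyticCompletion U t).re = (U t).re := by
  have hstar : star U = U := by
    apply Lp.ext
    filter_upwards [Lp.coeFn_star U, hU] with t h1 h2
    rw [h1]
    exact Complex.conj_eq_iff_im.2 h2
  have hc (n : ℤ) : conj (fourierCoeff U (-n)) = fourierCoeff U n := by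
    rw [← fourierCoeff_star, hstar]
  have hA : ∀ n < 0, fourierCoeff (analyticCompletion U) n = 0 := analyticCompletion_mem_H2 U
  have key : analyticCompletion U + star (analyticCompletion U) = (2 : ℂ) • U := by
    apply ext_fourierCoeff
    intro n
    rw [fourierCoeff_add', fourierCoeff_star, fourierCoeff_smul']
    rcases lt_trichotomy n 0 with hn | rfl | hn
    · obtain ⟨k, rfl⟩ : ∃ k : ℕ, n = -k := ⟨n.natAbs, by omega⟩
      have hk : k ≠ 0 := by omega
      rw [hA _ hn, neg_neg, fourierCoeff_analyticCompletion, if_neg hk, map_mul, zero_add,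
        ← hc (-k), neg_neg, Complex.conj_ofNat]
    · have := fourierCoeff_analyticCompletion U 0
      simp only [Nat.cast_zero, if_true, one_mul] at this
      have h0 := hc 0
      rw [neg_zero] at h0 ⊢
      rw [this, h0]
      ring
    · lift n to ℕ using hn.le
      have hk : n ≠ 0 := by omega
      rw [hA (-n) (by omega), fourierCoeff_analyticCompletion, if_neg hk, map_zero, add_zero]
  filter_upwards [Lp.coeFn_add (analyticCompletion U) (star (analyticCompletion U)),
    Lp.coeFn_star (analyticCompletion U), Lp.coeFn_smul (2 : ℂ) U] with t h1 h2 h3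
  rw [key, h3, Pi.add_apply, h2] at h1
  have := congrArg Complex.re h1
  simp at this
  linarith

/-! ### Extension to the disc and the Herglotz kernel -/

theorem norm_fourierCoeff_le (f : L2) (n : ℤ) : ‖fourierCoeff f n‖ ≤ ‖f‖ := by
  rw [fourierCoeff_eq_inner]
  refine (norm_inner_le_norm _ _).trans ?_
  rw [orthonormal_fourier.1 n, one_mul]

theorem summable_fourierCoeff_mul_pow (f : L2) {r : ℝ} (h0 : 0 ≤ r) (h1 : r < 1) :
    Summable fun n : ℕ => ‖fourierCoeff f n‖ * r ^ n :=
  ((summable_geometric_of_lt_one h0 h1).mul_left ‖f‖).of_nonneg_of_le (fun n => by positivity)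
    fun n => by gcongr; exact norm_fourierCoeff_le f n

theorem hasSum_eval (f : L2) {z : ℂ} (hz : ‖z‖ < 1) :
    HasSum (fun n : ℕ => fourierCoeff f (n : ℤ) * z ^ n) (eval f z) := by
  refine Summable.hasSum (Summable.of_norm ?_)
  simpa using summable_fourierCoeff_mul_pow f (norm_nonneg z) hz

theorem eval_add (f g : L2) {z : ℂ} (hz : ‖z‖ < 1) : eval (f + g) z = eval f z + eval g z := by
  refine HasSum.unique (hasSum_eval _ hz) ?_
  simpa only [fourierCoeff_add', add_mul] using (hasSum_eval f hz).add (hasSum_eval g hz)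

theorem differentiableOn_eval (f : L2) : DifferentiableOn ℂ (eval f) (Metric.ball 0 1) := by
  intro z hz
  rw [mem_ball_zero_iff] at hz
  obtain ⟨r, hr, hr1⟩ := exists_between hz
  have h0 : 0 ≤ r := (norm_nonneg z).trans hr.le
  have := Complex.differentiableOn_tsum_of_summable_norm (U := Metric.ball (0 : ℂ) r)
    (F := fun (n : ℕ) w => fourierCoeff f (n : ℤ) * w ^ n)
    (summable_fourierCoeff_mul_pow f h0 hr1) (fun n => by fun_prop)
    Metric.isOpen_ball (fun n w hw => by
      rw [mem_ball_zero_iff] at hw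
      rw [norm_mul, norm_pow]
      gcongr)
  exact (this.differentiableAt (Metric.isOpen_ball.mem_nhds (by simpa using hr))).differentiableWithinAt

theorem norm_fourier_apply (n : ℤ) (t : Torus) : ‖fourier n t‖ = 1 := by
  rw [fourier_apply, Circle.norm_coe]

theorem fourier_natCast (n : ℕ) (t : Torus) : fourier (n : ℤ) t = fourier 1 t ^ n := by
  simp [fourier_apply, toCircle_nsmul]

theorem fourier_neg_natCast (n : ℕ) (t : Torus) : fourier (-n : ℤ) t = (fourier 1 t)⁻¹ ^ n := by
  rw [fourier_neg, fourier_natCast, map_pow, Complex.inv_eq_conj (norm_fourier_apply 1 t)]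

/-- The Herglotz kernel as a function on the circle. -/
def kern (z : ℂ) (t : Torus) : ℂ := (fourier 1 t + z) / (fourier 1 t - z)

theorem fourier_sub_ne_zero {z : ℂ} (hz : ‖z‖ < 1) (t : Torus) : fourier 1 t - z ≠ 0 := by
  intro h
  rw [← sub_eq_zero.1 h, norm_fourier_apply] at hz
  exact lt_irrefl _ hz

theorem continuous_kern {z : ℂ} (hz : ‖z‖ < 1) : Continuous (kern z) :=
  (((fourier 1).continuous.add continuous_const).div
    ((fourier 1).continuous.sub continuous_const) (fourier_sub_ne_zero hz))

/-- With w = e^{it}, (w + z)/(w − z) = 2/(1 − z/w) − 1, a geometric series. Its coefficients 1, 2,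
2, … are those by which `analyticCompletion` multiplies Û(n). -/
theorem hasSum_kern {z : ℂ} (hz : ‖z‖ < 1) (t : Torus) :
    HasSum (fun n : ℕ => (if n = 0 then 1 else 2) * z ^ n * fourier (-n : ℤ) t) (kern z t) := by
  have hw : fourier 1 t ≠ 0 := norm_ne_zero_iff.1 (by rw [norm_fourier_apply]; exact one_ne_zero)
  have hq : ‖z * (fourier 1 t)⁻¹‖ < 1 := by
    rwa [norm_mul, norm_inv, norm_fourier_apply, inv_one, mul_one]
  have h := ((hasSum_geometric_of_norm_lt_one hq).mul_left 2).sub (hasSum_ite_eq 0 (1 : ℂ))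
  convert! h using 1
  · ext n
    rw [fourier_neg_natCast, mul_pow]
    rcases eq_or_ne n 0 with rfl | hn
    · norm_num
    · simp [hn]
      ring
  · have := fourier_sub_ne_zero hz t
    have h2 : 1 - z * (fourier 1 t)⁻¹ ≠ 0 := by
      intro h
      apply this
      field_simp at h
      simpa using h
    unfold kern
    field_simp
    ring

theorem integrable_of_L2 (f : L2) : Integrable f arc :=
  (Lp.memLp f).integrable (by norm_num)

theorem eval_analyticCompletion (U : L2) {z : ℂ} (hz : ‖z‖ < 1) :
    eval (analyticCompletion U) z = ∫ t, kern z t * U t ∂arc := by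
  have hF : ∀ n : ℕ, Integrable (fun t => (if n = 0 then 1 else 2) * z ^ n *
      (fourier (-n : ℤ) t * U t)) arc := fun n =>
    ((integrable_of_L2 U).fourier_smul (-n)).const_mul _
  have h := hasSum_integral_of_summable_integral_norm hF ?_
  · refine (hasSum_eval _ hz).unique ?_
    convert! h using 1
    · ext n
      rw [integral_const_mul, fourierCoeff_analyticCompletion, fourierCoeff]
      simp only [smul_eq_mul]
      ring
    · congr 1
      ext t
      rw [← ((hasSum_kern hz t).mul_right (U t)).tsum_eq]
      simp only [mul_assoc]
  · refine ((summable_geometric_of_lt_one (norm_nonneg z) hz).mul_left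
      (2 * ∫ t, ‖U t‖ ∂arc)).of_nonneg_of_le (fun n => integral_nonneg fun t => norm_nonneg _)
      fun n => ?_
    rw [mul_right_comm, ← integral_const_mul]
    refine integral_mono_of_nonneg (.of_forall fun t => norm_nonneg _)
      ((integrable_of_L2 U).norm.const_mul _) (.of_forall fun t => ?_)
    simp only [norm_mul, norm_fourier_apply, norm_pow, one_mul]
    gcongr
    split_ifs <;> simp

theorem re_kern_nonneg {z : ℂ} (hz : ‖z‖ < 1) (t : Torus) : 0 ≤ (kern z t).re := by
  have h1 : ‖fourier 1 t‖ ^ 2 = 1 := by rw [norm_fourier_apply, one_pow]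
  rw [Complex.sq_norm, Complex.normSq_apply] at h1
  have h2 : ‖z‖ ^ 2 ≤ 1 := by nlinarith [norm_nonneg z]
  rw [Complex.sq_norm, Complex.normSq_apply] at h2
  rw [kern, Complex.div_re, ← add_div]
  refine div_nonneg ?_ (Complex.normSq_nonneg _)
  simp only [Complex.add_re, Complex.sub_re, Complex.add_im, Complex.sub_im]
  nlinarith

/-- The Herglotz formula applied to U = 1, which is its own completion. -/
theorem integral_kern {z : ℂ} (hz : ‖z‖ < 1) : ∫ t, kern z t ∂arc = 1 := by
  have h : HasSum (fun n : ℕ => fourierCoeff (analyticCompletion one) n * z ^ n) 1 := by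
    convert! hasSum_ite_eq 0 (1 : ℂ) using 1
    ext n
    rw [fourierCoeff_analyticCompletion, one, fourierCoeff_fourierLp]
    rcases eq_or_ne n 0 with rfl | hn
    · simp
    · simp [hn]
  have h2 := h.unique (hasSum_eval _ hz)
  rw [eval_analyticCompletion _ hz] at h2
  rw [h2]
  refine integral_congr_ae ?_
  filter_upwards [coeFn_fourierLp (T := 2 * Real.pi) 2 0] with t ht
  rw [one, ht, fourier_zero, mul_one]

theorem integrable_of_continuous {f : Torus → ℂ} (hf : Continuous f) : Integrable f arc :=
  hf.integrable_of_hasCompactSupport (HasCompactSupport.of_compactSpace _)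

/-- The real part is the average of U against the Poisson kernel, the real part of `kern z`, which
is nonnegative with mean 1. This bound dominates the dilations of exp(A U). -/
theorem re_eval_analyticCompletion_le {U : L2} (hU : ∀ᵐ t ∂arc, (U t).im = 0) {B : ℝ}
    (hB : ∀ᵐ t ∂arc, (U t).re ≤ B) {z : ℂ} (hz : ‖z‖ < 1) :
    (eval (analyticCompletion U) z).re ≤ B := by
  have hk : Integrable (kern z) arc := integrable_of_continuous (continuous_kern hz)
  obtain ⟨C, hC⟩ := (isCompact_range (continuous_kern hz)).isBounded.exists_norm_le
  have hi : Integrable (fun t => kern z t * U t) arc :=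
    (integrable_of_L2 U).bdd_mul (c := C) (continuous_kern hz).aestronglyMeasurable
      (.of_forall fun t => hC _ ⟨t, rfl⟩)
  have h1 : ∫ t, (kern z t).re ∂arc = 1 := by
    have := integral_re hk
    simp only [RCLike.re_to_complex] at this
    rw [this, integral_kern hz, Complex.one_re]
  have h2 := integral_re hi
  simp only [RCLike.re_to_complex] at h2
  rw [eval_analyticCompletion U hz, ← h2]
  calc ∫ t, (kern z t * U t).re ∂arc ≤ ∫ t, (kern z t).re * B ∂arc := by
        refine integral_mono_ae hi.re (hk.re.mul_const B) ?_
        filter_upwards [hU, hB] with t h3 h4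
        simp only [Complex.mul_re, h3, mul_zero, sub_zero]
        exact mul_le_mul_of_nonneg_left h4 (re_kern_nonneg hz t)
    _ = B := by rw [integral_mul_const, h1, one_mul]

theorem coeFn_one : ∀ᵐ t ∂arc, one t = 1 := by
  filter_upwards [coeFn_fourierLp (T := 2 * Real.pi) 2 0] with t ht
  rw [one, ht, fourier_zero]

/-! ### Power-series multipliers and radial limits -/

/-- A function given on the circle by an absolutely convergent power series, times `f`, is the
sum of the corresponding series of shifts of `f`. -/
theorem tendsto_sum_smul_mulL {a : ℕ → ℂ} (ha : Summable fun n => ‖a n‖) {K : Torus → ℂ}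
    (hK : ∀ t, HasSum (fun n => a n * fourier 1 t ^ n) (K t)) {f g : L2}
    (hg : g =ᵐ[arc] fun t => K t * f t) :
    Tendsto (fun N => ∑ n ∈ Finset.range N, a n • mulL (fourierLp ∞ (n : ℤ)) f) atTop (𝓝 g) := by
  have hcoe : ∀ N, (∑ n ∈ Finset.range N, a n • mulL (fourierLp ∞ (n : ℤ)) f : L2) =ᵐ[arc]
      fun t => (∑ n ∈ Finset.range N, a n * fourier 1 t ^ n) * f t := by
    intro N
    induction N with
    | zero =>
      simp only [Finset.range_zero, Finset.sum_empty, zero_mul]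
      exact Lp.coeFn_zero ℂ 2 arc
    | succ N ih =>
      rw [Finset.sum_range_succ]
      filter_upwards [ih, Lp.coeFn_add (∑ n ∈ Finset.range N, a n • mulL (fourierLp ∞ (n : ℤ)) f)
        (a N • mulL (fourierLp ∞ (N : ℤ)) f), Lp.coeFn_smul (a N) (mulL (fourierLp ∞ (N : ℤ)) f),
        coeFn_mulL_fourierLp N f] with t h1 h2 h3 h4
      rw [h2, Pi.add_apply, h1, h3, Pi.smul_apply, h4, Finset.sum_range_succ, fourier_natCast,
        smul_eq_mul]
      ring
  refine tendsto_of_dominated (b := fun t => (∑' n, ‖a n‖) * ‖f t‖)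
    ((Lp.memLp f).norm.const_mul _) (fun N => ?_) ?_
  · filter_upwards [hcoe N] with t ht
    rw [ht, norm_mul]
    gcongr
    refine (norm_sum_le _ _).trans ?_
    refine le_trans (Finset.sum_le_sum fun n _ => ?_) (ha.sum_le_tsum _ fun n _ => norm_nonneg _)
    rw [norm_mul, norm_pow, norm_fourier_apply, one_pow, mul_one]
  · filter_upwards [ae_all_iff.2 hcoe, hg] with t h1 h2
    simp only [h1, h2]
    exact (hK t).tendsto_sum_nat.mul_const _

theorem tendsto_fourierCoeff {ι : Type*} {l : Filter ι} {G : ι → L2} {g : L2}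
    (h : Tendsto G l (𝓝 g)) (n : ℤ) :
    Tendsto (fun j => fourierCoeff (G j) n) l (𝓝 (fourierCoeff g n)) := by
  simp only [fourierCoeff_eq_inner]
  exact tendsto_const_nhds.inner h

theorem fourierCoeff_of_tendsto_sum {a : ℕ → ℂ} {g : L2}
    (h : Tendsto (fun N => ∑ n ∈ Finset.range N, a n • mulL (fourierLp ∞ (n : ℤ)) one) atTop (𝓝 g))
    (k : ℕ) : fourierCoeff g k = a k := by
  have h1 := tendsto_fourierCoeff h k
  refine tendsto_nhds_unique h1 (tendsto_const_nhds.congr' ?_)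
  filter_upwards [eventually_gt_atTop k] with N hN
  rw [fourierCoeff_eq_inner]
  simp only [inner_sum, inner_smul_right, ← fourierCoeff_eq_inner, fourierCoeff_mulL_fourierLp, one,
    fourierCoeff_fourierLp]
  rw [Finset.sum_eq_single_of_mem k (Finset.mem_range.2 hN)]
  · simp
  · intro b _ hb
    rw [if_neg (by omega), mul_zero]

theorem mem_cyclic_of_tendsto_sum {a : ℕ → ℂ} {f g : L2}
    (h : Tendsto (fun N => ∑ n ∈ Finset.range N, a n • mulL (fourierLp ∞ (n : ℤ)) f) atTop (𝓝 g)) :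
    g ∈ cyclic f :=
  (isClosed_cyclic f).mem_of_tendsto h (.of_forall fun _ =>
    Submodule.sum_mem _ fun n _ => Submodule.smul_mem _ _ (mulL_mem_cyclic f n))

theorem norm_ofReal_mul_fourier_lt {r : ℝ} (h0 : 0 < r) (h1 : r < 1) (t : Torus) :
    ‖(r : ℂ) * fourier 1 t‖ < 1 := by
  rwa [norm_mul, norm_fourier_apply, mul_one, Complex.norm_real, Real.norm_of_nonneg h0.le]

theorem continuous_comp_dilation {Φ : ℂ → ℂ} (hΦ : DifferentiableOn ℂ Φ (Metric.ball 0 1)) {r : ℝ}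
    (h0 : 0 < r) (h1 : r < 1) : Continuous fun t : Torus => Φ (r * fourier 1 t) :=
  hΦ.continuousOn.comp_continuous (continuous_const.mul (fourier 1).continuous) fun t => by
    rw [mem_ball_zero_iff]
    exact norm_ofReal_mul_fourier_lt h0 h1 t

theorem memLp_mul_of_continuous {K : Torus → ℂ} (hK : Continuous K) (f : L2) :
    MemLp (fun t => K t * f t) 2 arc := by
  obtain ⟨C, hC⟩ := (isCompact_range hK).isBounded.exists_norm_le
  exact memLp_of_bound_mul (Lp.memLp f) hK.aestronglyMeasurable C (.of_forall fun t => hC _ ⟨t, rfl⟩)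

/-- Dilations of an `H²` function converge to the boundary function almost everywhere along a
sequence of radii tending to `1`. -/
theorem exists_radii_tendsto_ae {f : L2} (hf : f ∈ H2) :
    ∃ r : ℕ → ℝ, (∀ j, 0 < r j) ∧ (∀ j, r j < 1) ∧ Tendsto r atTop (𝓝 1) ∧
      ∀ᵐ t ∂arc, Tendsto (fun j => eval f (r j * fourier 1 t)) atTop (𝓝 (f t)) := by
  -- The shift by 2 makes ρ 0 = 1/2 rather than 0.
  let ρ : ℕ → ℝ := fun j => 1 - 1 / ((j : ℝ) + 2)
  have hρ (j : ℕ) : 0 < ρ j ∧ ρ j < 1 := by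
    have : (1 : ℝ) / (j + 2) < 1 := by
      rw [div_lt_one (by positivity)]
      linarith [j.cast_nonneg (α := ℝ)]
    exact ⟨by simp only [ρ]; linarith, by simp only [ρ]; linarith [show (0 : ℝ) < 1 / (j + 2) by positivity]⟩
  have hlim : Tendsto ρ atTop (𝓝 1) := by
    have := (tendsto_one_div_add_atTop_nhds_zero_nat (𝕜 := ℝ)).comp (tendsto_add_atTop_nat 1)
    have := tendsto_const_nhds (x := (1 : ℝ)).sub this
    rw [sub_zero] at this
    refine this.congr fun j => ?_
    simp only [ρ, Function.comp, Nat.cast_add, Nat.cast_one]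
    ring
  have hc (j : ℕ) : Continuous fun t : Torus => eval f (ρ j * fourier 1 t) :=
    continuous_comp_dilation (differentiableOn_eval f) (hρ j).1 (hρ j).2
  let F : ℕ → L2 := fun j => (memLp_mul_of_continuous (hc j) one).toLp
  have hF (j : ℕ) : F j =ᵐ[arc] fun t => eval f (ρ j * fourier 1 t) * one t := MemLp.coeFn_toLp _
  have hsum (j : ℕ) := tendsto_sum_smul_mulL (a := fun n => fourierCoeff f n * (ρ j : ℂ) ^ n) (by
      simpa [abs_of_pos (hρ j).1] using summable_fourierCoeff_mul_pow f (hρ j).1.le (hρ j).2)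
    (fun t => by
      simpa only [mul_pow, mul_assoc] using
        hasSum_eval f (norm_ofReal_mul_fourier_lt (hρ j).1 (hρ j).2 t)) (hF j)
  have hcoef (j : ℕ) (n : ℤ) : fourierCoeff (F j) n = fourierCoeff f n * (ρ j : ℂ) ^ n.natAbs := by
    rcases lt_or_ge n 0 with hn | hn
    · rw [hf n hn, zero_mul]
      exact isOuter_one.le (mem_cyclic_of_tendsto_sum (hsum j)) n hn
    · lift n to ℕ using hn
      exact fourierCoeff_of_tendsto_sum (hsum j) n
  -- By Parseval the squared distance is ∑ |f̂(n)|² |ρⁿ − 1|², dominated by ∑ |f̂(n)|². A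
  -- subsequence then converges a.e.
  have hL2 : Tendsto F atTop (𝓝 f) := by
    rw [tendsto_iff_norm_sub_tendsto_zero]
    have key : Tendsto (fun j => ∑' n : ℤ, ‖fourierCoeff (F j - f : L2) n‖ ^ 2) atTop
        (𝓝 (∑' _ : ℤ, (0 : ℝ))) := by
      refine tendsto_tsum_of_dominated_convergence (bound := fun n : ℤ => ‖fourierCoeff f n‖ ^ 2)
        (hasSum_sq_fourierCoeff f).summable (fun n => ?_) (.of_forall fun j n => ?_)
      · simp only [fourierCoeff_sub', hcoef]
        have h1 : Tendsto (fun j => (ρ j : ℂ) ^ n.natAbs) atTop (𝓝 1) := by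
          simpa using ((Complex.continuous_ofReal.tendsto 1).comp hlim).pow n.natAbs
        have h2 := ((h1.const_mul (fourierCoeff f n)).sub_const (fourierCoeff f n)).norm.pow 2
        simpa using h2
      · rw [Real.norm_of_nonneg (by positivity), fourierCoeff_sub', hcoef]
        have h1 : (ρ j : ℂ) ^ n.natAbs - 1 = ((ρ j ^ n.natAbs - 1 : ℝ) : ℂ) := by push_cast; rfl
        have h2 : fourierCoeff f n * (ρ j : ℂ) ^ n.natAbs - fourierCoeff f n =
            fourierCoeff f n * ((ρ j ^ n.natAbs - 1 : ℝ) : ℂ) := by rw [← h1]; ring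
        rw [h2, norm_mul, Complex.norm_real, Real.norm_eq_abs]
        gcongr
        refine mul_le_of_le_one_right (norm_nonneg _) ?_
        have h3 : ρ j ^ n.natAbs ≤ 1 := pow_le_one₀ (hρ j).1.le (hρ j).2.le
        have h4 : 0 < ρ j ^ n.natAbs := pow_pos (hρ j).1 _
        rw [abs_le]
        constructor <;> linarith
    simp only [tsum_zero, tsum_sq_fourierCoeff, ← norm_sq_eq_integral] at key
    have := key.sqrt
    simpa [Real.sqrt_sq] using this
  obtain ⟨ns, hns, hae⟩ := (tendstoInMeasure_of_tendsto_Lp hL2).exists_seq_tendsto_ae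
  refine ⟨ρ ∘ ns, fun j => (hρ _).1, fun j => (hρ _).2, hlim.comp hns.tendsto_atTop, ?_⟩
  filter_upwards [hae, ae_all_iff.2 hF, coeFn_one] with t h1 h2 h3
  refine h1.congr fun j => ?_
  rw [h2, h3, mul_one]
  rfl

theorem exists_taylor {Φ : ℂ → ℂ} (hΦ : DifferentiableOn ℂ Φ (Metric.ball 0 1)) :
    ∃ a : ℕ → ℂ, ∀ z : ℂ, ‖z‖ < 1 → HasSum (fun n => a n * z ^ n) (Φ z) := by
  refine ⟨fun n => (n.factorial : ℂ)⁻¹ * iteratedDeriv n Φ 0, fun z hz => ?_⟩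
  have := Complex.hasSum_taylorSeries_on_ball hΦ (z := z) (by simpa using hz)
  convert! this using 2 with n
  simp
  ring

/-! ### Outer functions with prescribed modulus -/

theorem aestronglyMeasurable_exp (f : L2) :
    AEStronglyMeasurable (fun t => Complex.exp (f t)) arc :=
  Complex.continuous_exp.comp_aestronglyMeasurable (Lp.aestronglyMeasurable f)

theorem norm_exp_analyticCompletion_le {U : L2} (hU : ∀ᵐ t ∂arc, (U t).im = 0) {B : ℝ}
    (hB : ∀ᵐ t ∂arc, (U t).re ≤ B) :
    ∀ᵐ t ∂arc, ‖Complex.exp (analyticCompletion U t)‖ ≤ Real.exp B := by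
  filter_upwards [re_analyticCompletion hU, hB] with t h1 h2
  rw [Complex.norm_exp, h1]
  exact Real.exp_le_exp.2 h2

/-- Multiplication by `exp (analyticCompletion U)`, `U` bounded above, is approximated by the
dilated power series of `exp ∘ eval (analyticCompletion U)`. -/
theorem exp_analyticCompletion_mul_approx {U : L2} (hU : ∀ᵐ t ∂arc, (U t).im = 0) {B : ℝ}
    (hB : ∀ᵐ t ∂arc, (U t).re ≤ B) {f g : L2}
    (hg : g =ᵐ[arc] fun t => Complex.exp (analyticCompletion U t) * f t) :
    ∃ (a : ℕ → ℂ) (r : ℕ → ℝ) (G : ℕ → L2), Tendsto r atTop (𝓝 1) ∧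
      (∀ z : ℂ, ‖z‖ < 1 →
        HasSum (fun n => a n * z ^ n) (Complex.exp (eval (analyticCompletion U) z))) ∧
      (∀ j, Tendsto (fun N => ∑ n ∈ Finset.range N,
        (a n * (r j : ℂ) ^ n) • mulL (fourierLp ∞ (n : ℤ)) f) atTop (𝓝 (G j))) ∧
      Tendsto G atTop (𝓝 g) := by
  have hd : DifferentiableOn ℂ (fun z => Complex.exp (eval (analyticCompletion U) z))
      (Metric.ball 0 1) := (differentiableOn_eval _).cexp
  obtain ⟨a, ha⟩ := exists_taylor hd
  obtain ⟨r, hr0, hr1, hr, hae⟩ := exists_radii_tendsto_ae (analyticCompletion_mem_H2 U)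
  have hc (j : ℕ) := continuous_comp_dilation hd (hr0 j) (hr1 j)
  let G : ℕ → L2 := fun j => (memLp_mul_of_continuous (hc j) f).toLp
  have hG (j : ℕ) : G j =ᵐ[arc] fun t =>
    Complex.exp (eval (analyticCompletion U) (r j * fourier 1 t)) * f t := MemLp.coeFn_toLp _
  refine ⟨a, r, G, hr, ha, fun j => ?_, ?_⟩
  · refine tendsto_sum_smul_mulL ?_ (fun t => ?_) (hG j)
    · have h := (ha (r j) (by
        rw [Complex.norm_real, Real.norm_of_nonneg (hr0 j).le]; exact hr1 j)).summable
      exact h.norm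
    · simpa only [mul_pow, mul_assoc] using ha _ (norm_ofReal_mul_fourier_lt (hr0 j) (hr1 j) t)
  · refine tendsto_of_dominated (b := fun t => Real.exp B * ‖f t‖)
      ((Lp.memLp f).norm.const_mul _) (fun j => ?_) ?_
    · filter_upwards [hG j] with t ht
      rw [ht, norm_mul, Complex.norm_exp]
      gcongr
      exact re_eval_analyticCompletion_le hU hB (norm_ofReal_mul_fourier_lt (hr0 j) (hr1 j) t)
    · filter_upwards [ae_all_iff.2 hG, hg, hae] with t h1 h2 h3
      simp only [h1, h2]
      exact ((Complex.continuous_exp.tendsto _).comp h3).mul_const _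

theorem exp_analyticCompletion_mul_mem_cyclic {U : L2} (hU : ∀ᵐ t ∂arc, (U t).im = 0) {B : ℝ}
    (hB : ∀ᵐ t ∂arc, (U t).re ≤ B) {f g : L2}
    (hg : g =ᵐ[arc] fun t => Complex.exp (analyticCompletion U t) * f t) : g ∈ cyclic f := by
  obtain ⟨a, r, G, -, -, hG, hlim⟩ := exp_analyticCompletion_mul_approx hU hB hg
  exact (isClosed_cyclic f).mem_of_tendsto hlim (.of_forall fun j => mem_cyclic_of_tendsto_sum (hG j))

/-- The dilations have Taylor coefficients aₙ rⁿ and converge in L², so the boundary function has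
Fourier coefficients aₙ: exponentiation commutes with extension to the disc. -/
theorem eval_exp_analyticCompletion {U : L2} (hU : ∀ᵐ t ∂arc, (U t).im = 0) {B : ℝ}
    (hB : ∀ᵐ t ∂arc, (U t).re ≤ B) {F : L2}
    (hF : F =ᵐ[arc] fun t => Complex.exp (analyticCompletion U t)) {z : ℂ} (hz : ‖z‖ < 1) :
    eval F z = Complex.exp (eval (analyticCompletion U) z) := by
  have hF' : F =ᵐ[arc] fun t => Complex.exp (analyticCompletion U t) * one t := by
    filter_upwards [hF, coeFn_one] with t h1 h2
    rw [h1, h2, mul_one]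
  obtain ⟨a, r, G, hr, ha, hG, hlim⟩ := exp_analyticCompletion_mul_approx hU hB hF'
  have hcoef (n : ℕ) : fourierCoeff F n = a n := by
    have h1 := tendsto_fourierCoeff hlim n
    simp only [fourierCoeff_of_tendsto_sum (hG _)] at h1
    have h2 : Tendsto (fun j => a n * (r j : ℂ) ^ n) atTop (𝓝 (a n)) := by
      simpa using (((Complex.continuous_ofReal.tendsto 1).comp hr).pow n).const_mul (a n)
    exact tendsto_nhds_unique h1 h2
  rw [← (ha z hz).tsum_eq, eval]
  simp only [hcoef]

theorem memLp_exp_analyticCompletion {U : L2} (hU : ∀ᵐ t ∂arc, (U t).im = 0) {B : ℝ}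
    (hB : ∀ᵐ t ∂arc, (U t).re ≤ B) :
    MemLp (fun t => Complex.exp (analyticCompletion U t)) 2 arc :=
  MemLp.of_bound (aestronglyMeasurable_exp _) (Real.exp B) (norm_exp_analyticCompletion_le hU hB)

/-- Szegő's outer functions: if `U` is real and bounded above, `exp (analyticCompletion U)` is
outer. -/
theorem isOuter_exp_analyticCompletion {U : L2} (hU : ∀ᵐ t ∂arc, (U t).im = 0) {B : ℝ}
    (hB : ∀ᵐ t ∂arc, (U t).re ≤ B) {F : L2}
    (hF : F =ᵐ[arc] fun t => Complex.exp (analyticCompletion U t)) : IsOuter F := by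
  have hFH : F ∈ H2 := by
    refine isOuter_one.le (exp_analyticCompletion_mul_mem_cyclic (f := one) hU hB ?_)
    filter_upwards [hF, coeFn_one] with t h1 h2
    rw [h1, h2, mul_one]
  refine isOuter_of_one_mem hFH ?_
  -- U need not be bounded below, so 1/F may be unbounded. Truncating U at −k gives V k with −V k ≤
  -- k, so exp(A(−V k)) is a bounded multiplier.
  have hmem (k : ℕ) : MemLp (fun t => ((max (U t).re (-k) : ℝ) : ℂ)) 2 arc := by
    refine (Lp.memLp U).of_le ?_ (.of_forall fun t => ?_)
    · exact Complex.continuous_ofReal.comp_aestronglyMeasurable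
        ((Complex.continuous_re.comp_aestronglyMeasurable (Lp.aestronglyMeasurable U)).sup
          aestronglyMeasurable_const)
    · rw [Complex.norm_real, Real.norm_eq_abs]
      refine le_trans ?_ (Complex.abs_re_le_norm (U t))
      have := k.cast_nonneg (α := ℝ)
      rcases le_total (U t).re (-k) with h | h
      · rw [max_eq_right h, abs_neg, abs_of_nonneg this]
        exact le_abs.2 (Or.inr (by linarith))
      · rw [max_eq_left h]
  let V : ℕ → L2 := fun k => (hmem k).toLp
  have hV (k : ℕ) : V k =ᵐ[arc] fun t => ((max (U t).re (-k) : ℝ) : ℂ) := MemLp.coeFn_toLp _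
  have hVlim : Tendsto V atTop (𝓝 U) := by
    refine tendsto_of_dominated (b := fun t => ‖U t‖) (Lp.memLp U).norm (fun k => ?_) ?_
    · filter_upwards [hV k] with t ht
      rw [ht, Complex.norm_real, Real.norm_eq_abs]
      refine le_trans ?_ (Complex.abs_re_le_norm (U t))
      have := k.cast_nonneg (α := ℝ)
      rcases le_total (U t).re (-k) with h | h
      · rw [max_eq_right h, abs_neg, abs_of_nonneg this]
        exact le_abs.2 (Or.inr (by linarith))
      · rw [max_eq_left h]
    · filter_upwards [ae_all_iff.2 hV, hU] with t h1 h2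
      refine tendsto_const_nhds.congr' ?_
      obtain ⟨N, hN⟩ := exists_nat_ge (-(U t).re)
      filter_upwards [eventually_ge_atTop N] with k hk
      have : (N : ℝ) ≤ k := by exact_mod_cast hk
      rw [h1, max_eq_left (by linarith)]
      exact (Complex.ext rfl (by simp [h2]))
  have hAlim : Tendsto (fun k => analyticCompletion (U - V k)) atTop (𝓝 0) := by
    have := (analyticCompletion.continuous.tendsto 0).comp
      (f := fun k => U - V k) (by simpa using hVlim.const_sub U)
    rwa [map_zero] at this
  obtain ⟨ns, hns, hae⟩ := (tendstoInMeasure_of_tendsto_Lp hAlim).exists_seq_tendsto_ae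
  have hre (k : ℕ) : ∀ᵐ t ∂arc, ((U - V k : L2) t).im = 0 ∧ ((U - V k : L2) t).re ≤ 0 := by
    filter_upwards [Lp.coeFn_sub U (V k), hV k, hU] with t h1 h2 h3
    rw [h1, Pi.sub_apply, h2]
    refine ⟨by simp [h3], ?_⟩
    rw [Complex.sub_re, Complex.ofReal_re]
    linarith [le_max_left (U t).re (-k)]
  have him (k : ℕ) := (hre k).mono fun t h => h.1
  have hle (k : ℕ) := (hre k).mono fun t h => h.2
  -- G k = exp(A(−V k)) F lies in the cyclic space of F. As U − V k ≤ 0 tends to 0 in L², G k is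
  -- bounded by 1 and tends to 1 along a subsequence.
  let G : ℕ → L2 := fun k => (memLp_exp_analyticCompletion (him k) (hle k)).toLp
  have hG (k : ℕ) : G k =ᵐ[arc] fun t => Complex.exp (analyticCompletion (U - V k) t) :=
    MemLp.coeFn_toLp _
  have hGmem (k : ℕ) : G k ∈ cyclic F := by
    refine exp_analyticCompletion_mul_mem_cyclic (U := -V k) (B := k) ?_ ?_ ?_
    · filter_upwards [Lp.coeFn_neg (V k), hV k] with t h1 h2
      rw [h1, Pi.neg_apply, h2, Complex.neg_im, Complex.ofReal_im, neg_zero]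
    · filter_upwards [Lp.coeFn_neg (V k), hV k] with t h1 h2
      rw [h1, Pi.neg_apply, h2, Complex.neg_re, Complex.ofReal_re]
      linarith [le_max_right (U t).re (-k)]
    · have e : analyticCompletion (U - V k) = analyticCompletion (-V k) + analyticCompletion U := by
        rw [← map_add]
        congr 1
        abel
      filter_upwards [hG k, hF, Lp.coeFn_add (analyticCompletion (-V k)) (analyticCompletion U)]
        with t h1 h2 h3
      rw [h1, h2, e, h3, Pi.add_apply, Complex.exp_add]
  refine (isClosed_cyclic F).mem_of_tendsto (f := G ∘ ns) (b := atTop) ?_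
    (.of_forall fun k => hGmem (ns k))
  refine tendsto_of_dominated (b := fun _ => 1) (memLp_const 1) (fun k => ?_) ?_
  · filter_upwards [hG (ns k), norm_exp_analyticCompletion_le (him (ns k)) (hle (ns k))] with t h1 h2
    rw [Function.comp, h1]
    simpa using h2
  · filter_upwards [hae, ae_all_iff.2 hG, coeFn_one, Lp.coeFn_zero ℂ 2 arc] with t h1 h2 h3 h4
    simp only [Function.comp, h2, h3]
    rw [h4, Pi.zero_apply] at h1
    rw [← Complex.exp_zero]
    exact (Complex.continuous_exp.tendsto _).comp h1

/-! ### Rigidity of outer functions, and an outer polynomial -/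

theorem eq_smul_one_of_star_mem_H2 {f : L2} (hf : f ∈ H2) (hs : star f ∈ H2) :
    f = fourierCoeff f 0 • one := by
  apply ext_fourierCoeff
  intro n
  rw [fourierCoeff_smul', one, fourierCoeff_fourierLp]
  rcases lt_trichotomy n 0 with hn | rfl | hn
  · rw [hf n hn, if_neg hn.ne, mul_zero]
  · rw [if_pos rfl, mul_one]
  · have := hs (-n) (by omega)
    rw [fourierCoeff_star, neg_neg, map_eq_zero] at this
    rw [this, if_neg hn.ne', mul_zero]

theorem mulL_comm (u v : Lp ℂ ∞ arc) (f : L2) : mulL u (mulL v f) = mulL v (mulL u f) := by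
  apply Lp.ext
  filter_upwards [coeFn_mulL u (mulL v f), coeFn_mulL v (mulL u f), coeFn_mulL u f, coeFn_mulL v f]
    with t h1 h2 h3 h4
  rw [h1, h2, h3, h4]
  ring

/-- Multiplication by u sends every χⁿf into the closed space H², hence also the limit 1 of their
combinations. -/
theorem mulL_one_mem_H2 {u : Lp ℂ ∞ arc} {f : L2} (hf : IsOuter f) (h : mulL u f ∈ H2) :
    mulL u one ∈ H2 :=
  map_mem_of_mem_cyclic isClosed_H2 (mulL u) (fun n => by
    rw [mulL_comm]
    exact mulL_fourierLp_mem_H2 n h) (hf.ge (fourierLp_mem_H2 0))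

/-- If `u` multiplies some outer function into `H²`, and `conj u` does, then `u` is constant. -/
theorem ae_eq_const_of_mulL_mem {u : Lp ℂ ∞ arc} {f g : L2} (hf : IsOuter f) (hg : IsOuter g)
    (huf : mulL u f ∈ H2) (hug : mulL (star u) g ∈ H2) : ∃ a : ℂ, ∀ᵐ t ∂arc, u t = a := by
  have h1 := mulL_one_mem_H2 hf huf
  have h2 := mulL_one_mem_H2 hg hug
  have h3 : star (mulL u one) = mulL (star u) one := by
    apply Lp.ext
    filter_upwards [Lp.coeFn_star (mulL u one), coeFn_mulL u one, coeFn_mulL (star u) one,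
      Lp.coeFn_star u, coeFn_one] with t e1 e2 e3 e4 e5
    rw [e1, Pi.star_apply, e2, e3, e4, e5, Pi.star_apply, mul_one, mul_one]
  rw [← h3] at h2
  have h4 := eq_smul_one_of_star_mem_H2 h1 h2
  set a := fourierCoeff (mulL u one) 0
  refine ⟨a, ?_⟩
  filter_upwards [coeFn_mulL u one, Lp.coeFn_smul a one, coeFn_one] with t e1 e2 e3
  rw [h4, e2, Pi.smul_apply, e3] at e1
  simpa using e1.symm

theorem exists_unimodular_mul {f g : L2} (hf : ∀ᵐ t ∂arc, f t ≠ 0)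
    (hfg : ∀ᵐ t ∂arc, ‖g t‖ = ‖f t‖) :
    ∃ u : Lp ℂ ∞ arc, (∀ᵐ t ∂arc, ‖u t‖ = 1) ∧ (∀ᵐ t ∂arc, g t = u t * f t) ∧
      mulL u f = g := by
  have hae : ∀ᵐ t ∂arc, ‖g t / f t‖ = 1 := by
    filter_upwards [hf, hfg] with t h1 h2
    rw [norm_div, h2, div_self (norm_ne_zero_iff.2 h1)]
  have hm : MemLp (fun t => g t / f t) ∞ arc :=
    memLp_top_of_bound ((Lp.aestronglyMeasurable g).div₀ (Lp.aestronglyMeasurable f)) 1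
      (hae.mono fun t h => h.le)
  have h2 : ∀ᵐ t ∂arc, g t = (hm.toLp _) t * f t := by
    filter_upwards [hm.coeFn_toLp, hf] with t h1 h2
    rw [h1, div_mul_cancel₀ _ h2]
  refine ⟨hm.toLp _, ?_, h2, ?_⟩
  · filter_upwards [hm.coeFn_toLp, hae] with t h1 h2
    rw [h1, h2]
  · apply Lp.ext
    filter_upwards [coeFn_mulL (hm.toLp _) f, h2] with t h1 h2
    rw [h1, h2]

/-- Outer functions are determined by their modulus, up to a unimodular constant. -/
theorem IsOuter.eq_smul_of_norm_eq {f g : L2} (hf : IsOuter f) (hg : IsOuter g)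
    (h0 : ∀ᵐ t ∂arc, f t ≠ 0) (hfg : ∀ᵐ t ∂arc, ‖g t‖ = ‖f t‖) :
    ∃ a : ℂ, ‖a‖ = 1 ∧ g = a • f := by
  obtain ⟨u, hu1, hu2, hu3⟩ := exists_unimodular_mul h0 hfg
  have hug : mulL (star u) g = f := by
    apply Lp.ext
    filter_upwards [coeFn_mulL (star u) g, Lp.coeFn_star u, hu1, hu2] with t h1 h2 h3 h4
    rw [h1, h2, h4, Pi.star_apply, ← mul_assoc, RCLike.star_def, RCLike.conj_mul, h3]
    simp
  obtain ⟨a, ha⟩ := ae_eq_const_of_mulL_mem hf hg (hu3 ▸ hg.mem_H2) (hug ▸ hf.mem_H2)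
  refine ⟨a, ?_, ?_⟩
  · obtain ⟨t, h1, h2⟩ := (ha.and hu1).exists
    rw [← h1, h2]
  · apply Lp.ext
    filter_upwards [ha, hu2, Lp.coeFn_smul a f] with t h1 h2 h3
    rw [h2, h3, h1, Pi.smul_apply, smul_eq_mul]

/-- `c z² + conj c` is outer. -/
theorem isOuter_quadratic {c : ℂ} (hc : c ≠ 0) :
    IsOuter (c • (fourierLp 2 2 : L2) + conj c • one) := by
  set p : L2 := c • (fourierLp 2 2 : L2) + conj c • one with hp
  have hpH : p ∈ H2 := H2.add_mem (H2.smul_mem _ (fourierLp_mem_H2 2))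
    (H2.smul_mem _ (fourierLp_mem_H2 0))
  refine le_antisymm (cyclic_le_H2 hpH) fun f hf => ?_
  have : CompleteSpace (cyclic p) := (isClosed_cyclic p).completeSpace_coe
  have hPf : (cyclic p).starProjection f ∈ cyclic p := Submodule.starProjection_apply_mem _ _
  set k := f - (cyclic p).starProjection f with hk
  have hkH : k ∈ H2 := H2.sub_mem hf (cyclic_le_H2 hpH hPf)
  have hko : k ∈ (cyclic p)ᗮ := Submodule.sub_starProjection_mem_orthogonal f
  have hshift (n : ℕ) : mulL (fourierLp ∞ (n : ℤ)) p =
      c • (fourierLp 2 ((n + 2 : ℕ) : ℤ) : L2) + conj c • (fourierLp 2 (n : ℤ) : L2) := by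
    rw [hp, map_add, map_smul, map_smul, mulL_fourierLp_one, ← mulL_fourierLp_one 2,
      mulL_mulL_fourierLp, mulL_fourierLp_one]
    push_cast
    rfl
  -- Orthogonality to χⁿp is a two-term recursion with coefficients of equal modulus |c|.
  -- Square-summability then forces k = 0.
  have hrec (n : ℕ) : ‖fourierCoeff k ((n + 2 : ℕ) : ℤ)‖ = ‖fourierCoeff k (n : ℤ)‖ := by
    have h := Submodule.inner_right_of_mem_orthogonal (mulL_mem_cyclic p n) hko
    rw [hshift, inner_add_left, inner_smul_left, inner_smul_left, ← fourierCoeff_eq_inner,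
      ← fourierCoeff_eq_inner, Complex.conj_conj] at h
    have h2 := congrArg norm (eq_neg_of_add_eq_zero_left h)
    rw [norm_neg, norm_mul, norm_mul, RCLike.norm_conj] at h2
    exact mul_left_cancel₀ (norm_ne_zero_iff.2 hc) h2
  have hlim : Tendsto (fun n : ℕ => ‖fourierCoeff k (n : ℤ)‖ ^ 2) atTop (𝓝 0) :=
    ((hasSum_sq_fourierCoeff k).summable.comp_injective Nat.cast_injective).tendsto_atTop_zero
  have hzero (n : ℕ) : fourierCoeff k (n : ℤ) = 0 := by
    have h1 : ∀ j : ℕ, ‖fourierCoeff k ((n + 2 * j : ℕ) : ℤ)‖ = ‖fourierCoeff k (n : ℤ)‖ := by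
      intro j
      induction j with
      | zero => rfl
      | succ j ih => rw [← ih, ← hrec (n + 2 * j)]; rfl
    have h2 : Tendsto (fun j : ℕ => n + 2 * j) atTop atTop :=
      tendsto_atTop_mono (fun j => by simp only [id]; omega) tendsto_id
    have h3 := hlim.comp h2
    simp only [Function.comp_def, h1] at h3
    have := tendsto_nhds_unique h3 tendsto_const_nhds
    simpa using this.symm
  have hk0 : k = 0 := by
    apply ext_fourierCoeff
    intro n
    have h0 : fourierCoeff (0 : L2) n = 0 := by rw [fourierCoeff_eq_inner, inner_zero_right]
    rw [h0]
    rcases lt_or_ge n 0 with hn | hn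
    · exact hkH n hn
    · lift n to ℕ using hn
      exact hzero n
  rw [sub_eq_zero.1 (hk.symm.trans hk0)]
  exact hPf

/-! ### Trigonometric polynomials cχ + conj(cχ) -/

/-- An integrable function on the circle with vanishing Fourier coefficients is zero. -/
theorem ae_eq_zero_of_fourierCoeff_eq_zero {w : Torus → ℂ} (hw : Integrable w arc)
    (h : ∀ n, fourierCoeff w n = 0) : w =ᵐ[arc] 0 := by
  have hint (g : C(Torus, ℂ)) : Integrable (fun t => g t * w t) arc :=
    hw.bdd_mul (c := ‖g‖) g.continuous.aestronglyMeasurable (.of_forall fun t => g.norm_coe_le_norm t)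
  let L : C(Torus, ℂ) →L[ℂ] ℂ := LinearMap.mkContinuous
    { toFun := fun g => ∫ t, g t * w t ∂arc
      map_add' := fun g₁ g₂ => by
        rw [← integral_add (hint g₁) (hint g₂)]
        simp only [ContinuousMap.add_apply, add_mul]
      map_smul' := fun a g => by
        rw [RingHom.id_apply, smul_eq_mul, ← integral_const_mul]
        simp only [ContinuousMap.smul_apply, smul_eq_mul, mul_assoc] }
    (∫ t, ‖w t‖ ∂arc) fun g => by
      refine (norm_integral_le_integral_norm _).trans ?_
      rw [mul_comm _ ‖g‖, ← integral_const_mul]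
      refine integral_mono (hint g).norm (hw.norm.const_mul _) fun t => ?_
      simp only [norm_mul]
      gcongr
      exact g.norm_coe_le_norm t
  -- Since w is only in L¹, the Hilbert basis does not apply. Density of trigonometric polynomials
  -- in C(𝕋) is used instead, followed by continuous approximation of indicators of closed sets.
  have hL (g : C(Torus, ℂ)) : ∫ t, g t * w t ∂arc = 0 := by
    have h1 : (Submodule.span ℂ (Set.range (fourier (T := 2 * Real.pi)))).topologicalClosure ≤
        LinearMap.ker (L : C(Torus, ℂ) →ₗ[ℂ] ℂ) := by
      refine Submodule.topologicalClosure_minimal _ ?_ L.isClosed_ker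
      rw [Submodule.span_le]
      rintro _ ⟨n, rfl⟩
      have := h (-n)
      rw [fourierCoeff, neg_neg] at this
      exact this
    rw [span_fourier_closure_eq_top] at h1
    exact h1 (Submodule.mem_top (x := g))
  refine ae_eq_zero_of_forall_setIntegral_isClosed_eq_zero hw fun F hF => ?_
  have hlim : Tendsto (fun n => ∫ t, ((hF.apprSeq n t : ℝ) : ℂ) * w t ∂arc) atTop
      (𝓝 (∫ t, F.indicator w t ∂arc)) := by
    refine tendsto_integral_of_dominated_convergence (fun t => ‖w t‖) (fun n => ?_) hw.norm
      (fun n => .of_forall fun t => ?_) (.of_forall fun t => ?_)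
    · exact (Continuous.aestronglyMeasurable (by fun_prop)).mul hw.1
    · rw [norm_mul, Complex.norm_real, Real.norm_of_nonneg (NNReal.coe_nonneg _)]
      refine mul_le_of_le_one_left (norm_nonneg _) ?_
      exact_mod_cast HasOuterApproxClosed.apprSeq_apply_le_one hF n t
    · have h1 := (tendsto_pi_nhds.1 (HasOuterApproxClosed.tendsto_apprSeq hF)) t
      have h2 : Tendsto (fun n => ((hF.apprSeq n t : ℝ) : ℂ)) atTop
          (𝓝 (((F.indicator (fun _ => (1 : NNReal)) t : NNReal) : ℝ) : ℂ)) :=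
        (Complex.continuous_ofReal.tendsto _).comp ((NNReal.continuous_coe.tendsto _).comp h1)
      convert! h2.mul_const (w t) using 2
      by_cases ht : t ∈ F <;> simp [ht]
  rw [← integral_indicator hF.measurableSet]
  refine tendsto_nhds_unique hlim (tendsto_const_nhds.congr fun n => ?_)
  exact (hL ⟨fun t => ((hF.apprSeq n t : ℝ) : ℂ), by fun_prop⟩).symm

theorem ofReal_trig (c : ℂ) (t : Torus) :
    (trig c t : ℂ) = c * fourier 1 t + conj (c * fourier 1 t) := by
  rw [Complex.add_conj, trig]

theorem continuous_trig (c : ℂ) : Continuous (trig c) := by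
  unfold trig
  fun_prop

theorem fourier_one_coe (x : ℝ) : (fourier 1 (x : Torus) : ℂ) = Complex.exp (x * Complex.I) := by
  rw [fourier_coe_apply]
  congr 1
  push_cast
  field_simp

/-- The angle form of `trig`. -/
theorem trig_coe (c : ℂ) (x : ℝ) :
    trig c (x : Torus) = 2 * ‖c‖ * Real.sin (x + (c.arg + Real.pi / 2)) := by
  rw [trig, fourier_one_coe]
  nth_rw 1 [← Complex.norm_mul_exp_arg_mul_I c]
  rw [mul_assoc, ← Complex.exp_add, ← add_mul, Complex.re_ofReal_mul, ← Complex.ofReal_add,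
    Complex.exp_ofReal_mul_I_re, ← add_assoc, Real.sin_add_pi_div_two, add_comm x, mul_assoc]

theorem ae_arc_of_ae_volume {p : Torus → Prop} (h : ∀ᵐ t ∂(volume : Measure Torus), p t) :
    ∀ᵐ t ∂arc, p t := by
  rw [volume_eq_smul_haarAddCircle] at h
  exact (Measure.ae_ennreal_smul_measure_iff (by simp [Real.pi_pos])).1 h

theorem trig_ne_zero {c : ℂ} (hc : c ≠ 0) : ∀ᵐ t ∂arc, trig c t ≠ 0 := by
  refine ae_arc_of_ae_volume ?_
  rw [← (AddCircle.measurePreserving_mk (2 * Real.pi) 0).map_eq]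
  refine (ae_map_iff (AddCircle.measurable_mk' (a := 2 * Real.pi)).aemeasurable
    (isOpen_ne_fun (continuous_trig c) continuous_const).measurableSet).2 (ae_restrict_of_ae ?_)
  rw [ae_iff]
  refine Set.Countable.measure_zero ((Set.countable_range
    fun n : ℤ => n * Real.pi - (c.arg + Real.pi / 2)).mono ?_) _
  intro x hx
  simp only [ne_eq, not_not, Set.mem_ofPred_eq] at hx
  rw [trig_coe, mul_eq_zero_iff_left (by simpa using hc), Real.sin_eq_zero_iff] at hx
  obtain ⟨n, hn⟩ := hx
  exact ⟨n, by simp only [hn]; ring⟩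

theorem intervalIntegrable_log_sin_sq (a b : ℝ) :
    IntervalIntegrable (fun x => Real.log (Real.sin x) ^ 2) volume a b := by
  have hmeas : Measurable fun x => Real.log (Real.sin x) ^ 2 := by fun_prop
  have h1 : IntervalIntegrable (fun x => Real.log (Real.sin x) ^ 2) volume 0 (Real.pi / 2) := by
    have hr : IntervalIntegrable (fun x : ℝ => 16 * (2 / Real.pi * x) ^ (-1 / 2 : ℝ)) volume 0
        (Real.pi / 2) := by
      have := (intervalIntegral.intervalIntegrable_rpow' (a := 0) (b := 1)
        (r := (-1 / 2 : ℝ)) (by norm_num)).comp_mul_left (c := 2 / Real.pi)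
      rw [zero_div, one_div_div] at this
      exact this.const_mul 16
    -- On (0, π/2], |log s| ≤ 4 s^(−1/4) for s = sin x, and s ≥ 2x/π. Hence log² s is at most 16
    -- (2x/π)^(−1/2), which is integrable.
    refine hr.mono_fun hmeas.aestronglyMeasurable ?_
    rw [Set.uIoc_of_le (by positivity)]
    filter_upwards [ae_restrict_mem measurableSet_Ioc] with x hx
    have h2 : 0 < 2 / Real.pi * x := mul_pos (by positivity) hx.1
    have h3 : 2 / Real.pi * x ≤ Real.sin x := Real.mul_le_sin hx.1.le hx.2
    have h4 : 0 < Real.sin x := h2.trans_le h3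
    have h5 := Real.abs_log_mul_self_rpow_lt (Real.sin x) (1 / 4) h4 (Real.sin_le_one x)
      (by norm_num)
    have h6 : |Real.log (Real.sin x)| ≤ 4 * Real.sin x ^ (-1 / 4 : ℝ) := by
      rw [abs_mul, abs_of_pos (Real.rpow_pos_of_pos h4 _), one_div_one_div] at h5
      have h7 : (0 : ℝ) < Real.sin x ^ (1 / 4 : ℝ) := Real.rpow_pos_of_pos h4 _
      rw [neg_div, Real.rpow_neg h4.le, ← div_eq_mul_inv, le_div_iff₀ h7]
      exact h5.le
    rw [Real.norm_of_nonneg (sq_nonneg _), Real.norm_of_nonneg (by positivity)]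
    calc Real.log (Real.sin x) ^ 2 = |Real.log (Real.sin x)| ^ 2 := (sq_abs _).symm
      _ ≤ (4 * Real.sin x ^ (-1 / 4 : ℝ)) ^ 2 := by gcongr
      _ = 16 * Real.sin x ^ (-1 / 2 : ℝ) := by
        rw [mul_pow, ← Real.rpow_natCast (Real.sin x ^ _), ← Real.rpow_mul h4.le]
        norm_num
      _ ≤ 16 * (2 / Real.pi * x) ^ (-1 / 2 : ℝ) := by
        gcongr 16 * ?_
        exact Real.rpow_le_rpow_of_nonpos h2 h3 (by norm_num)
  have h2 : IntervalIntegrable (fun x => Real.log (Real.sin x) ^ 2) volume (Real.pi / 2)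
      Real.pi := by
    have := (h1.comp_sub_left Real.pi).symm
    simp only [Real.sin_pi_sub, sub_zero] at this
    convert! this using 1
    ring
  refine Function.Periodic.intervalIntegrable₀ (T := Real.pi) (fun x => ?_) Real.pi_ne_zero
    (h1.trans h2) a b
  -- `Real.log` ignores signs, so the period is π rather than 2π.
  simp only [Real.sin_add_pi, Real.log_neg_eq_log]

theorem memLp_log_trig (c : ℂ) : MemLp (fun t => Real.log |trig c t|) 2 arc := by
  rcases eq_or_ne c 0 with rfl | hc
  · simp [trig]
  have hmeas : Measurable fun t => Real.log |trig c t| :=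
    Real.measurable_log.comp (continuous_trig c).abs.measurable
  suffices h : MemLp (fun t => ((Real.log |trig c t| : ℝ) : ℂ)) 2 (volume : Measure Torus) by
    have h2 := (memLp_haarAddCircle_iff.2 h).re
    simpa using h2
  refine MemLp.ofReal ?_
  rw [← (AddCircle.measurePreserving_mk (2 * Real.pi) 0).map_eq]
  refine (memLp_map_measure_iff hmeas.aestronglyMeasurable
    (AddCircle.measurable_mk' (a := 2 * Real.pi)).aemeasurable).2 ?_
  set β := c.arg + Real.pi / 2
  have hsin : MemLp (fun x => Real.log (Real.sin (x + β))) 2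
      (volume.restrict (Set.Ioc 0 (0 + 2 * Real.pi))) := by
    refine (memLp_two_iff_integrable_sq (Measurable.aestronglyMeasurable (by fun_prop))).2 ?_
    rw [← IntegrableOn, ← intervalIntegrable_iff_integrableOn_Ioc_of_le (by linarith [Real.pi_pos])]
    have := (intervalIntegrable_log_sin_sq (0 + β) (0 + 2 * Real.pi + β)).comp_add_right β
    simpa using this
  refine ((memLp_const |Real.log (2 * ‖c‖)|).add hsin.norm).of_le
    ((hmeas.comp AddCircle.measurable_mk').aestronglyMeasurable) (.of_forall fun x => ?_)
  have h0 : 2 * ‖c‖ ≠ 0 := by simpa using hc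
  simp only [Function.comp, Pi.add_apply, Real.log_abs, trig_coe, Real.norm_eq_abs]
  rw [abs_of_nonneg (a := |_| + |_|) (by positivity)]
  rcases eq_or_ne (Real.sin (x + β)) 0 with h | h
  · rw [h]
    simp
  · rw [Real.log_mul h0 h]
    exact abs_add_le _ _

theorem fourierCoeff_trig (c : ℂ) (n : ℤ) :
    fourierCoeff (fun t => (trig c t : ℂ)) n =
      (if n = 1 then c else 0) + (if n = -1 then conj c else 0) := by
  have hT : (fun t => (trig c t : ℂ)) =ᵐ[arc]
      (c • (fourierLp 2 1 : L2) + conj c • (fourierLp 2 (-1) : L2) : L2) := by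
    filter_upwards [Lp.coeFn_add (c • (fourierLp 2 1 : L2)) (conj c • (fourierLp 2 (-1) : L2)),
      Lp.coeFn_smul c (fourierLp 2 1 : L2), Lp.coeFn_smul (conj c) (fourierLp 2 (-1) : L2),
      coeFn_fourierLp (T := 2 * Real.pi) 2 1, coeFn_fourierLp (T := 2 * Real.pi) 2 (-1)]
      with t h1 h2 h3 h4 h5
    rw [h1, Pi.add_apply, h2, h3, Pi.smul_apply, Pi.smul_apply, h4, h5, ofReal_trig, map_mul,
      fourier_neg, smul_eq_mul, smul_eq_mul]
  rw [fourierCoeff_congr_ae hT, fourierCoeff_add', fourierCoeff_smul', fourierCoeff_smul',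
    fourierCoeff_fourierLp, fourierCoeff_fourierLp]
  simp only [mul_ite, mul_one, mul_zero]

/-- A real integrable function whose only nonzero Fourier coefficients are those of index `±1`. -/
theorem exists_ae_eq_trig {w : Torus → ℝ} (hw : Integrable w arc)
    (h0 : fourierCoeff (fun t => (w t : ℂ)) 0 = 0)
    (h2 : ∀ n : ℕ, 2 ≤ n → fourierCoeff (fun t => (w t : ℂ)) n = 0) :
    ∀ᵐ t ∂arc, w t = trig (fourierCoeff (fun t => (w t : ℂ)) 1) t := by
  set c := fourierCoeff (fun t => (w t : ℂ)) 1 with hc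
  have hneg (n : ℤ) : fourierCoeff (fun t => (w t : ℂ)) (-n) =
      conj (fourierCoeff (fun t => (w t : ℂ)) n) := by
    unfold fourierCoeff
    rw [← integral_conj]
    congr 1
    ext t
    simp
  have hi : Integrable (fun t => (trig c t : ℂ)) arc :=
    integrable_of_continuous (Complex.continuous_ofReal.comp (continuous_trig c))
  have hz := ae_eq_zero_of_fourierCoeff_eq_zero (hw.ofReal.sub hi) fun n => ?_
  · filter_upwards [hz] with t ht
    have : (w t : ℂ) - trig c t = 0 := ht
    exact_mod_cast sub_eq_zero.1 this
  have hs : fourierCoeff ((fun t => (w t : ℂ)) - fun t => (trig c t : ℂ)) n =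
      fourierCoeff (fun t => (w t : ℂ)) n - fourierCoeff (fun t => (trig c t : ℂ)) n := by
    simp only [fourierCoeff, Pi.sub_apply, smul_sub]
    exact integral_sub (hw.ofReal.fourier_smul _) (hi.fourier_smul _)
  refine hs.trans ?_
  rw [fourierCoeff_trig]
  obtain ⟨k, rfl | rfl⟩ := n.eq_nat_or_neg
  · rcases lt_or_ge k 2 with hk | hk
    · interval_cases k
      · simp [h0]
      · simp [hc]
    · rw [h2 k hk, if_neg (by omega), if_neg (by omega)]
      simp
  · rw [hneg]
    rcases lt_or_ge k 2 with hk | hk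
    · interval_cases k
      · simp [h0]
      · simp [hc]
    · rw [h2 k hk, if_neg (by omega), if_neg (by omega)]
      simp

/-- If `Re (c z)` and `Re (d z)` never have opposite signs, then `d` is a nonnegative multiple
of `c`. -/
theorem exists_nonneg_smul_of_trig_mul_nonneg {c d : ℂ} (hc : c ≠ 0)
    (h : ∀ᵐ t ∂arc, 0 ≤ trig c t * trig d t) : ∃ r : ℝ, 0 ≤ r ∧ d = r * c := by
  -- The product is continuous and the measure has full support, so the inequality holds everywhere.
  have hall (x : ℝ) : 0 ≤ trig c (x : Torus) * trig d (x : Torus) := by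
    have hcont : Continuous fun t => trig c t * trig d t := (continuous_trig c).mul (continuous_trig d)
    have : {t | 0 ≤ trig c t * trig d t} = Set.univ :=
      (isClosed_le continuous_const hcont).closure_eq ▸
        (Measure.dense_of_ae (μ := arc) h).closure_eq
    exact (this ▸ Set.mem_univ _ : (x : Torus) ∈ {t | 0 ≤ trig c t * trig d t})
  rcases eq_or_ne d 0 with rfl | hd
  · exact ⟨0, le_rfl, by simp⟩
  have hcos : Real.cos (d.arg - c.arg) = 1 := by
    refine le_antisymm (Real.cos_le_one _) ?_
    -- This angle places the two sine phases symmetrically about 0, so the product is −4|c||d|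
    -- sin²((arg d − arg c)/2), which cannot be positive.
    have h1 := hall (-(c.arg + d.arg) / 2 - Real.pi / 2)
    rw [trig_coe, trig_coe] at h1
    have e1 : -(c.arg + d.arg) / 2 - Real.pi / 2 + (c.arg + Real.pi / 2) =
      -((d.arg - c.arg) / 2) := by ring
    have e2 : -(c.arg + d.arg) / 2 - Real.pi / 2 + (d.arg + Real.pi / 2) =
      (d.arg - c.arg) / 2 := by ring
    rw [e1, e2, Real.sin_neg] at h1
    have h2 : 0 < ‖c‖ * ‖d‖ := mul_pos (norm_pos_iff.2 hc) (norm_pos_iff.2 hd)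
    have h3 : Real.sin ((d.arg - c.arg) / 2) ^ 2 ≤ 0 := by
      by_contra! h3
      nlinarith [mul_pos h2 h3]
    have h4 := Real.cos_two_mul' ((d.arg - c.arg) / 2)
    rw [mul_div_cancel₀ _ two_ne_zero] at h4
    nlinarith [Real.sin_sq_add_cos_sq ((d.arg - c.arg) / 2)]
  have hexp : Complex.exp (((d.arg - c.arg : ℝ) : ℂ) * Complex.I) = 1 := by
    have hsin : Real.sin (d.arg - c.arg) = 0 := by
      nlinarith [Real.sin_sq_add_cos_sq (d.arg - c.arg)]
    rw [Complex.exp_mul_I, ← Complex.ofReal_cos, ← Complex.ofReal_sin, hcos, hsin]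
    simp
  refine ⟨‖d‖ / ‖c‖, by positivity, ?_⟩
  nth_rw 1 [← Complex.norm_mul_exp_arg_mul_I d]
  have hcn : (‖c‖ : ℂ) ≠ 0 := by simpa using hc
  have h2 : ((‖d‖ / ‖c‖ : ℝ) : ℂ) * c = ‖d‖ * Complex.exp (c.arg * Complex.I) := by
    have := Complex.norm_mul_exp_arg_mul_I c
    push_cast
    field_simp
    rw [mul_assoc, this, mul_comm]
  have h3 : Complex.exp (d.arg * Complex.I) = Complex.exp (c.arg * Complex.I) := by
    rw [← mul_one (Complex.exp (c.arg * Complex.I)), ← hexp, ← Complex.exp_add]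
    congr 1
    push_cast
    ring
  rw [h2, h3]

/-! ### The integral formulas for h_c and g_λ -/

theorem integral_arc (f : Torus → ℂ) :
    ∫ t, f t ∂arc = (1 / (2 * Real.pi) : ℂ) * ∫ t in (-Real.pi)..Real.pi, f (t : Torus) := by
  have h := fourierCoeff_eq_intervalIntegral f 0 (-Real.pi)
  simp only [fourierCoeff, neg_zero, fourier_zero, one_smul] at h
  rw [h, show -Real.pi + 2 * Real.pi = Real.pi by ring, Complex.real_smul]
  push_cast
  rfl

theorem herglotz_eq_kern (z : ℂ) (t : ℝ) : herglotz z t = kern z (t : Torus) := by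
  rw [herglotz, kern, fourier_one_coe, mul_comm Complex.I]

theorem exp_herglotz_integral {u : Torus → ℝ} {U : L2} (hU : U =ᵐ[arc] fun t => (u t : ℂ)) {z : ℂ}
    (hz : ‖z‖ < 1) :
    Complex.exp ((1 / (2 * Real.pi) : ℂ) * ∫ t in (-Real.pi)..Real.pi,
      herglotz z t * (u (t : Torus) : ℂ)) = Complex.exp (eval (analyticCompletion U) z) := by
  have h := integral_arc fun t => kern z t * (u t : ℂ)
  simp only [herglotz_eq_kern]
  rw [← h, eval_analyticCompletion U hz]
  congr 1
  refine integral_congr_ae ?_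
  filter_upwards [hU] with t ht
  rw [ht]

/-- At x = 0 both sides are 0 because `Real.log 0 = 0`. The integrands below thus agree at every
point, including the zeros of τ. -/
theorem log_rpow_of_nonneg {x : ℝ} (hx : 0 ≤ x) {y : ℝ} (hy : y ≠ 0) :
    Real.log (x ^ y) = y * Real.log x := by
  rcases hx.eq_or_lt with rfl | hx
  · rw [Real.zero_rpow hy, Real.log_zero, mul_zero]
  · exact Real.log_rpow hx y

theorem hFun_eq (c : ℂ) {U : L2}
    (hU : U =ᵐ[arc] fun t => ((1 / 2 * Real.log |trig c t| : ℝ) : ℂ)) {z : ℂ} (hz : ‖z‖ < 1) :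
    hFun c z = Complex.exp (eval (analyticCompletion U) z) := by
  rw [← exp_herglotz_integral hU hz, hFun]
  refine congrArg Complex.exp (congrArg _ (intervalIntegral.integral_congr fun t _ => ?_))
  have h2 : c * Complex.exp (Complex.I * t) + conj c * Complex.exp (-(Complex.I * t)) =
      (trig c (t : Torus) : ℂ) := by
    rw [ofReal_trig, fourier_one_coe, mul_comm (t : ℂ), map_mul, ← Complex.exp_conj, map_mul, Complex.conj_I, Complex.conj_ofReal,
      neg_mul]
  simp only [h2, Complex.norm_real, Real.norm_eq_abs]
  rw [log_rpow_of_nonneg (abs_nonneg _) (by norm_num)]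

theorem gFun_eq (φ : Torus → ℝ) (l : ℝ) {U : L2}
    (hU : U =ᵐ[arc] fun t => ((-1 / 2 * Real.log |φ t - l| : ℝ) : ℂ)) {z : ℂ} (hz : ‖z‖ < 1) :
    gFun φ l z = Complex.exp (eval (analyticCompletion U) z) := by
  rw [← exp_herglotz_integral hU hz, gFun]
  refine congrArg Complex.exp (congrArg _ (intervalIntegral.integral_congr fun t _ => ?_))
  rw [log_rpow_of_nonneg (abs_nonneg _) (by norm_num)]

theorem abs_trig_le (c : ℂ) (t : Torus) : |trig c t| ≤ 2 * ‖c‖ := by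
  rw [trig, abs_mul, abs_two]
  gcongr
  refine (Complex.abs_re_le_norm _).trans ?_
  rw [norm_mul, norm_fourier_apply, mul_one]

/-! ### The symbol and the outer solution -/

/-- The sign condition on the symbol makes `φ - l` bounded, bounded away from zero, and of the same
sign as `trig c`. -/
theorem symbol_bounds {φ : Torus → ℝ} (hφ : MemLp φ ∞ arc) {c : ℂ} (hc : c ≠ 0) {m M : ℝ}
    (hm : essSup φ (arc.restrict {t | trig c t < 0}) = m)
    (hM : essInf φ (arc.restrict {t | 0 < trig c t}) = M) {l : ℝ} (hl : l ∈ Set.Ioo m M) :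
    ∃ δ C : ℝ, 0 < δ ∧ ∀ᵐ t ∂arc, δ ≤ |φ t - l| ∧ |φ t - l| ≤ C ∧ 0 < (φ t - l) * trig c t := by
  obtain ⟨C, hC⟩ : ∃ C : ℝ, ∀ᵐ t ∂arc, |φ t| ≤ C :=
    ⟨(eLpNormEssSup φ arc).toReal, by
      have htop : eLpNormEssSup φ arc ≠ ∞ := by simpa using hφ.2.ne
      filter_upwards [ae_le_eLpNormEssSup (f := φ) (μ := arc)] with t ht
      have := ENNReal.toReal_mono htop ht
      rwa [toReal_enorm, Real.norm_eq_abs] at this⟩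
  have h1 : ∀ᵐ t ∂arc, trig c t < 0 → φ t ≤ m := by
    refine (ae_restrict_iff' (isOpen_lt (continuous_trig c) continuous_const).measurableSet).1 ?_
    rw [← hm]
    refine ae_le_essSup ⟨C, ?_⟩
    exact ae_restrict_of_ae (hC.mono fun t h => (abs_le.1 h).2)
  have h2 : ∀ᵐ t ∂arc, 0 < trig c t → M ≤ φ t := by
    refine (ae_restrict_iff' (isOpen_lt continuous_const (continuous_trig c)).measurableSet).1 ?_
    rw [← hM]
    refine ae_essInf_le ⟨-C, ?_⟩
    exact ae_restrict_of_ae (hC.mono fun t h => (abs_le.1 h).1)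
  refine ⟨min (l - m) (M - l), C + |l|, lt_min (sub_pos.2 hl.1) (sub_pos.2 hl.2), ?_⟩
  filter_upwards [h1, h2, hC, trig_ne_zero hc] with t e1 e2 e3 e4
  refine ⟨?_, (abs_sub _ _).trans (by gcongr), ?_⟩
  · rcases lt_or_gt_of_ne e4 with h | h
    · exact (min_le_left _ _).trans (le_abs.2 (Or.inr (by linarith [e1 h])))
    · exact (min_le_right _ _).trans (le_abs.2 (Or.inl (by linarith [e2 h])))
  · rcases lt_or_gt_of_ne e4 with h | h
    · exact mul_pos_of_neg_of_neg (by linarith [e1 h, hl.1]) h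
    · exact mul_pos (by linarith [e2 h, hl.2]) h

theorem eval_zero (f : L2) : eval f 0 = fourierCoeff f 0 := by
  refine (hasSum_eval f (by simp)).unique ?_
  have := hasSum_single (f := fun n : ℕ => fourierCoeff f (n : ℤ) * (0 : ℂ) ^ n) 0
    fun n hn => by simp [hn]
  simpa using this

theorem hasDerivAt_eval_zero (f : L2) : HasDerivAt (eval f) (fourierCoeff f 1) 0 := by
  -- The backward shift of f. It may have a coefficient of index −1, but `eval` sees only
  -- nonnegative indices.
  set g := mulL (fourierLp ∞ (-1)) f with hg
  have h0 : eval g 0 = fourierCoeff f 1 := by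
    rw [eval_zero, hg, fourierCoeff_mulL_fourierLp]
    rfl
  have hE : ∀ z : ℂ, ‖z‖ < 1 → eval f z = fourierCoeff f 0 + z * eval g z := by
    intro z hz
    rw [← (hasSum_eval f hz).tsum_eq, (hasSum_eval f hz).summable.tsum_eq_zero_add,
      ← (hasSum_eval g hz).tsum_eq, ← tsum_mul_left]
    congr 1
    · simp
    · refine tsum_congr fun n => ?_
      rw [hg, fourierCoeff_mulL_fourierLp, sub_neg_eq_add, pow_succ]
      push_cast
      ring
  have hd : HasDerivAt (eval g) (deriv (eval g) 0) 0 :=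
    ((differentiableOn_eval g).differentiableAt (Metric.ball_mem_nhds _ one_pos)).hasDerivAt
  have h1 := ((hasDerivAt_id (0 : ℂ)).mul hd).const_add (fourierCoeff f 0)
  rw [id, zero_mul, add_zero, one_mul, h0] at h1
  refine h1.congr_of_eventuallyEq ?_
  filter_upwards [Metric.ball_mem_nhds (0 : ℂ) one_pos] with z hz
  exact hE z (by simpa using hz)

theorem IsOuter.smul {f : L2} (hf : IsOuter f) {a : ℂ} (ha : a ≠ 0) : IsOuter (a • f) := by
  refine le_antisymm (cyclic_le_H2 (H2.smul_mem a hf.mem_H2)) ?_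
  rw [← hf]
  refine cyclic_le_cyclic ?_
  have := (cyclic (a • f)).smul_mem a⁻¹ (mem_cyclic_self (a • f))
  rwa [inv_smul_smul₀ ha] at this

theorem memLp_log_abs {ψ : Torus → ℝ} (hψ : AEStronglyMeasurable ψ arc) {δ C : ℝ} (hδ : 0 < δ)
    (h : ∀ᵐ t ∂arc, δ ≤ |ψ t| ∧ |ψ t| ≤ C) : MemLp (fun t => Real.log |ψ t|) 2 arc := by
  refine MemLp.of_bound (C := max |Real.log δ| |Real.log C|)
    (Real.measurable_log.comp_aemeasurable hψ.norm.aemeasurable).aestronglyMeasurable ?_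
  filter_upwards [h] with t ht
  have h1 := Real.log_le_log hδ ht.1
  have h2 := Real.log_le_log (hδ.trans_le ht.1) ht.2
  rw [Real.norm_eq_abs]
  exact abs_le_max_abs_abs h1 h2

/-- The outer functions attached to a symbol `ψ` having the sign of `trig c`: `f` solves
`ψ |f|² = trig c`, and `X` is outer and a multiple of `χ ψ conj f`. -/
theorem exists_outer_solution {φ : Torus → ℝ} (hφ : AEStronglyMeasurable φ arc) {c : ℂ}
    (hc : c ≠ 0) {l δ C : ℝ} (hδ : 0 < δ)
    (h : ∀ᵐ t ∂arc, δ ≤ |φ t - l| ∧ |φ t - l| ≤ C ∧ 0 < (φ t - l) * trig c t) :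
    IsOuterOnDisc (hFun c) ∧ IsOuterOnDisc (gFun φ l) ∧
    ∃ f X : L2, IsOuter f ∧ IsOuter X ∧ (∀ᵐ t ∂arc, f t ≠ 0) ∧
      (∀ᵐ t ∂arc, (φ t - l) * ‖f t‖ ^ 2 = trig c t) ∧
      (∀ z ∈ Metric.ball (0 : ℂ) 1, eval f z = hFun c z * gFun φ l z) ∧
      (∀ᵐ t ∂arc, X t = fourier 1 t * ((φ t - l : ℝ) * conj (f t))) := by
  have hψm : AEStronglyMeasurable (fun t => φ t - l) arc := hφ.sub aestronglyMeasurable_const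
  have hψlog := memLp_log_abs hψm hδ (h.mono fun t ht => ⟨ht.1, ht.2.1⟩)
  have hmh : MemLp (fun t => ((1 / 2 * Real.log |trig c t| : ℝ) : ℂ)) 2 arc :=
    ((memLp_log_trig c).const_mul (1 / 2)).ofReal
  have hmg : MemLp (fun t => ((-1 / 2 * Real.log |φ t - l| : ℝ) : ℂ)) 2 arc :=
    (hψlog.const_mul (-1 / 2)).ofReal
  set Uh : L2 := hmh.toLp _
  set Ug : L2 := hmg.toLp _
  have hUh : Uh =ᵐ[arc] fun t => ((1 / 2 * Real.log |trig c t| : ℝ) : ℂ) := hmh.coeFn_toLp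
  have hUg : Ug =ᵐ[arc] fun t => ((-1 / 2 * Real.log |φ t - l| : ℝ) : ℂ) := hmg.coeFn_toLp
  have hlog : ∀ᵐ t ∂arc, Real.log |trig c t| ≤ Real.log (2 * ‖c‖) ∧
      Real.log δ ≤ Real.log |φ t - l| ∧ Real.log |φ t - l| ≤ Real.log C := by
    filter_upwards [h, trig_ne_zero hc] with t h1 h2
    exact ⟨Real.log_le_log (abs_pos.2 h2) (abs_trig_le c t), Real.log_le_log hδ h1.1,
      Real.log_le_log (hδ.trans_le h1.1) h1.2.1⟩
  -- all outer functions below are `exp (analyticCompletion U)` for combinations `U` of `Uh`, `Ug`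
  have main : ∀ (U : L2) (α β : ℝ), 0 ≤ α → (∀ᵐ t ∂arc, U t =
      ((α * Real.log |trig c t| + β * Real.log |φ t - l| : ℝ) : ℂ)) →
      ∃ F : L2, IsOuter F ∧ (∀ᵐ t ∂arc, F t = Complex.exp (analyticCompletion U t)) ∧
        (∀ᵐ t ∂arc, ‖F t‖ = Real.exp (α * Real.log |trig c t| + β * Real.log |φ t - l|)) ∧
        ∀ z : ℂ, ‖z‖ < 1 → eval F z = Complex.exp (eval (analyticCompletion U) z) := by
    intro U α β hα hU
    have him : ∀ᵐ t ∂arc, (U t).im = 0 := hU.mono fun t ht => by rw [ht, Complex.ofReal_im]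
    -- Only an upper bound for log|τ| is available, hence α ≥ 0. The logarithm of |φ − l| is bounded
    -- on both sides, so β may have either sign.
    have hB : ∀ᵐ t ∂arc, (U t).re ≤
        α * Real.log (2 * ‖c‖) + max (β * Real.log δ) (β * Real.log C) := by
      filter_upwards [hU, hlog] with t h1 h2
      rw [h1, Complex.ofReal_re]
      refine add_le_add (mul_le_mul_of_nonneg_left h2.1 hα) ?_
      rcases le_total 0 β with hβ | hβ
      · exact le_max_of_le_right (mul_le_mul_of_nonneg_left h2.2.2 hβ)
      · exact le_max_of_le_left (mul_le_mul_of_nonpos_left h2.2.1 hβ)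
    have hF := (memLp_exp_analyticCompletion him hB).coeFn_toLp
    refine ⟨_, isOuter_exp_analyticCompletion him hB hF, hF, ?_,
      fun z hz => eval_exp_analyticCompletion him hB hF hz⟩
    filter_upwards [hF, re_analyticCompletion him, hU] with t h1 h2 h3
    rw [h1, Complex.norm_exp, h2, h3, Complex.ofReal_re]
  obtain ⟨Fh, hFh, -, -, hFh'⟩ := main Uh (1 / 2) 0 (by norm_num) (by
    filter_upwards [hUh] with t ht
    rw [ht, zero_mul, add_zero])
  obtain ⟨Fg, hFg, -, -, hFg'⟩ := main Ug 0 (-1 / 2) le_rfl (by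
    filter_upwards [hUg] with t ht
    rw [ht, zero_mul, zero_add])
  obtain ⟨f, hf, hfA, hfn, hf'⟩ := main (Uh + Ug) (1 / 2) (-1 / 2) (by norm_num) (by
    filter_upwards [hUh, hUg, Lp.coeFn_add Uh Ug] with t h1 h2 h3
    rw [h3, Pi.add_apply, h1, h2, ← Complex.ofReal_add])
  -- Y has modulus |τ|^(1/2) |φ − l|^(1/2) = |(φ − l) f|. Since 2Uh = (Uh + Ug) + (Uh − Ug), the
  -- function E below, of modulus |τ|, equals f·Y.
  obtain ⟨Y, hY, hYA, -, -⟩ := main (Uh - Ug) (1 / 2) (1 / 2) (by norm_num) (by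
    filter_upwards [hUh, hUg, Lp.coeFn_sub Uh Ug] with t h1 h2 h3
    rw [h3, Pi.sub_apply, h1, h2, ← Complex.ofReal_sub]
    congr 1
    ring)
  obtain ⟨E, hE, hEA, hEn, -⟩ := main (Uh + Uh) 1 0 (by norm_num) (by
    filter_upwards [hUh, Lp.coeFn_add Uh Uh] with t h1 h3
    rw [h3, Pi.add_apply, h1, ← Complex.ofReal_add]
    congr 1
    ring)
  have hsol : ∀ᵐ t ∂arc, (φ t - l) * ‖f t‖ ^ 2 = trig c t := by
    filter_upwards [hfn, h, trig_ne_zero hc] with t h1 h2 h3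
    have hp := abs_pos.2 h3
    have hq := hδ.trans_le h2.1
    have h4 : ‖f t‖ ^ 2 = |trig c t| / |φ t - l| := by
      rw [h1, ← Real.exp_nat_mul, ← Real.exp_log (div_pos hp hq), Real.log_div hp.ne' hq.ne']
      congr 1
      push_cast
      ring
    rw [h4, mul_div_assoc', div_eq_iff hq.ne']
    rcases lt_or_gt_of_ne h3 with h5 | h5
    · rw [abs_of_neg h5, abs_of_neg (neg_of_mul_pos_left h2.2.2 h5.le)]
      ring
    · rw [abs_of_pos h5, abs_of_pos (pos_of_mul_pos_left h2.2.2 h5.le)]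
      ring
  have hf0 : ∀ᵐ t ∂arc, f t ≠ 0 := by
    filter_upwards [hfA] with t ht
    rw [ht]
    exact Complex.exp_ne_zero _
  set p : L2 := c • (fourierLp 2 2 : L2) + conj c • one with hp
  have hpt : ∀ᵐ t ∂arc, p t = fourier 1 t * trig c t := by
    filter_upwards [Lp.coeFn_add (c • (fourierLp 2 2 : L2)) (conj c • one),
      Lp.coeFn_smul c (fourierLp 2 2 : L2), Lp.coeFn_smul (conj c) one, coeFn_one,
      coeFn_fourierLp (T := 2 * Real.pi) 2 2] with t h1 h2 h3 h4 h5
    have h6 : fourier 1 t * conj (fourier 1 t) = 1 := by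
      rw [RCLike.mul_conj, norm_fourier_apply]
      simp
    have h7 := fourier_natCast 2 t
    rw [Nat.cast_ofNat] at h7
    rw [hp, h1, Pi.add_apply, h2, h3, Pi.smul_apply, Pi.smul_apply, h4, h5, h7, ofReal_trig,
      map_mul, smul_eq_mul, smul_eq_mul]
    linear_combination (-conj c) * h6
  -- p = χτ and E are outer with the same modulus, so p = aE = f·(aY). Dividing χ(φ − l)|f|² = p by
  -- f identifies aY with χ(φ − l) conj f.
  obtain ⟨a, ha, hpa⟩ := hE.eq_smul_of_norm_eq (isOuter_quadratic hc)
    (by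
      filter_upwards [hEA] with t ht
      rw [ht]
      exact Complex.exp_ne_zero _)
    (by
      filter_upwards [hpt, hEn, trig_ne_zero hc] with t h1 h2 h3
      rw [← hp, h1, h2, norm_mul, norm_fourier_apply, Complex.norm_real, one_mul, zero_mul,
        add_zero, one_mul, Real.exp_log (abs_pos.2 h3), Real.norm_eq_abs])
  rw [← hp] at hpa
  refine ⟨⟨Fh, hFh, fun z hz => ?_⟩, ⟨Fg, hFg, fun z hz => ?_⟩, f, a • Y, hf,
    hY.smul (norm_ne_zero_iff.1 (by rw [ha]; exact one_ne_zero)), hf0, hsol, fun z hz => ?_, ?_⟩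
  · rw [mem_ball_zero_iff] at hz
    rw [hFun_eq c hUh hz, hFh' z hz]
  · rw [mem_ball_zero_iff] at hz
    rw [gFun_eq φ l hUg hz, hFg' z hz]
  · rw [mem_ball_zero_iff] at hz
    rw [hFun_eq c hUh hz, gFun_eq φ l hUg hz, hf' z hz, map_add, eval_add _ _ hz, Complex.exp_add]
  · have e1 : analyticCompletion (Uh + Uh) =
        analyticCompletion (Uh + Ug) + analyticCompletion (Uh - Ug) := by
      rw [← map_add]
      congr 1
      abel
    filter_upwards [hpt, hpa ▸ Lp.coeFn_smul a E, Lp.coeFn_smul a Y, hEA, hfA, hYA, hf0, hsol,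
      Lp.coeFn_add (analyticCompletion (Uh + Ug)) (analyticCompletion (Uh - Ug))]
      with t h1 h2 h3 h4 h5 h6 h7 h8 h9
    rw [e1, h9, Pi.add_apply, Complex.exp_add, ← h5, ← h6] at h4
    rw [h1, Pi.smul_apply, h4, smul_eq_mul, ← h8] at h2
    rw [h3, Pi.smul_apply, smul_eq_mul]
    have h10 : conj (f t) * f t = ((‖f t‖ ^ 2 : ℝ) : ℂ) := by
      rw [RCLike.conj_mul]
      norm_cast
    apply mul_right_cancel₀ h7
    rw [mul_assoc (fourier 1 t), mul_assoc _ (conj (f t)), h10, ← Complex.ofReal_mul, h2]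
    ring

/-! ### Subspaces of ℂ ⊕ ℂz orthogonal to f -/

theorem mem_linPoly {w : L2} : w ∈ linPoly ↔ ∃ a b : ℂ, a • one + b • chi = w :=
  Submodule.mem_span_pair

theorem inner_linPoly (a b : ℂ) (f : L2) :
    inner ℂ (a • one + b • chi) f = conj a * fourierCoeff f 0 + conj b * fourierCoeff f 1 := by
  rw [inner_add_left, inner_smul_left, inner_smul_left, one, chi, ← fourierCoeff_eq_inner,
    ← fourierCoeff_eq_inner]

theorem mem_H2V {W : Submodule ℂ L2} {f : L2} : f ∈ H2V W ↔ f ∈ H2 ∧ ∀ w ∈ W, inner ℂ w f = 0 := by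
  rw [H2V, Submodule.mem_inf, Submodule.mem_orthogonal]

/-- The vectors of `ℂ ⊕ ℂ z` orthogonal to `f`. -/
def linPolyPerp (f : L2) : Submodule ℂ L2 := linPoly ⊓ (Submodule.span ℂ {f})ᗮ

theorem mem_linPolyPerp {f w : L2} : w ∈ linPolyPerp f ↔ w ∈ linPoly ∧ inner ℂ w f = 0 := by
  rw [linPolyPerp, Submodule.mem_inf, Submodule.mem_orthogonal_singleton_iff_inner_left]

instance finiteDimensional_linPoly : FiniteDimensional ℂ linPoly :=
  FiniteDimensional.span_of_finite ℂ (by simp)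

theorem finrank_linPoly_le : Module.finrank ℂ linPoly ≤ 2 := by
  classical
  have h := finrank_span_finset_le_card (R := ℂ) ({one, chi} : Finset L2)
  rw [Finset.coe_pair] at h
  exact h.trans Finset.card_le_two

theorem linPolyPerp_ne_linPoly {f : L2} (hf : fourierCoeff f 0 ≠ 0) : linPolyPerp f ≠ linPoly := by
  intro h
  have h1 : one ∈ linPolyPerp f := h ▸ Submodule.subset_span (by simp)
  have h2 := (mem_linPolyPerp.1 h1).2
  rw [one, ← fourierCoeff_eq_inner] at h2
  exact hf h2

theorem linPolyPerp_ne_bot {f : L2} (hf : fourierCoeff f 0 ≠ 0) : linPolyPerp f ≠ ⊥ := by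
  refine (Submodule.ne_bot_iff _).2
    ⟨(-conj (fourierCoeff f 1)) • one + conj (fourierCoeff f 0) • chi,
      mem_linPolyPerp.2 ⟨mem_linPoly.2 ⟨_, _, rfl⟩, ?_⟩, fun h => ?_⟩
  · rw [inner_linPoly, map_neg, Complex.conj_conj, Complex.conj_conj]
    ring
  · have h1 := congrArg (inner ℂ chi) h
    rw [inner_zero_right, inner_add_right, inner_smul_right, inner_smul_right, one, chi,
      ← fourierCoeff_eq_inner, ← fourierCoeff_eq_inner, fourierCoeff_fourierLp,
      fourierCoeff_fourierLp] at h1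
    simp [hf] at h1

/-- W is a nonzero subspace of a proper subspace of a space of dimension at most 2, so both have
dimension 1. -/
theorem eq_linPolyPerp {f : L2} (hf : fourierCoeff f 0 ≠ 0) {W : Submodule ℂ L2} (hW : W ≤ linPoly)
    (hW0 : W ≠ ⊥) (hfW : ∀ w ∈ W, inner ℂ w f = 0) : W = linPolyPerp f := by
  have hle : W ≤ linPolyPerp f := fun w hw => mem_linPolyPerp.2 ⟨hW hw, hfW w hw⟩
  have hlt : linPolyPerp f < linPoly := lt_of_le_of_ne inf_le_left (linPolyPerp_ne_linPoly hf)
  have hfd : FiniteDimensional ℂ (linPolyPerp f) := Submodule.finiteDimensional_of_le hlt.le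
  have hfW : FiniteDimensional ℂ W := Submodule.finiteDimensional_of_le hW
  have h1 := (Submodule.finrank_lt_finrank_of_lt hlt).trans_le finrank_linPoly_le
  have h2 : 0 < Module.finrank ℂ W := by
    rw [Nat.pos_iff_ne_zero]
    exact fun h => hW0 (Submodule.finrank_eq_zero.1 h)
  exact Submodule.eq_of_le_of_finrank_le hle (by omega)

/-! ### The eigenvalue equation -/

/-- The function `(φ - l) f`. -/
def symbolMul (φ : Torus → ℝ) (hφ : MemLp φ ∞ arc) (l : ℝ) (f : L2) : L2 :=
  mulL (MemLp.toLp (fun t => (φ t : ℂ)) hφ.ofReal) f - (l : ℂ) • f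

theorem coeFn_symbolMul {φ : Torus → ℝ} (hφ : MemLp φ ∞ arc) (l : ℝ) (f : L2) :
    ∀ᵐ t ∂arc, symbolMul φ hφ l f t = ((φ t - l : ℝ) : ℂ) * f t := by
  filter_upwards [Lp.coeFn_sub (mulL (MemLp.toLp (fun t => (φ t : ℂ)) hφ.ofReal) f) ((l : ℂ) • f),
    Lp.coeFn_smul (l : ℂ) f, coeFn_mulL (MemLp.toLp (fun t => (φ t : ℂ)) hφ.ofReal) f,
    MemLp.coeFn_toLp (f := fun t => (φ t : ℂ)) hφ.ofReal] with t h1 h2 h3 h4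
  rw [symbolMul, h1, Pi.sub_apply, h2, h3, h4, Pi.smul_apply, smul_eq_mul]
  push_cast
  ring

theorem toeplitz_eq_smul_iff {φ : Torus → ℝ} (hφ : MemLp φ ∞ arc) (l : ℝ) {W : Submodule ℂ L2}
    (f : H2V W) : toeplitz φ hφ W f = (l : ℂ) • f ↔
      ∀ k ∈ H2V W, inner ℂ k (symbolMul φ hφ l (f : L2)) = 0 := by
  have h1 : toeplitz φ hφ W f - (l : ℂ) • f =
      (H2V W).orthogonalProjectionOnto (symbolMul φ hφ l (f : L2)) := by
    rw [symbolMul, map_sub, map_smul, Submodule.orthogonalProjectionOnto_mem_subspace_eq_self]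
    rfl
  rw [← sub_eq_zero, h1, Submodule.orthogonalProjectionOnto_eq_zero_iff, Submodule.mem_orthogonal]

/-- The inner products of `(φ - l) f` with the shifts of `f`. -/
theorem inner_mulL_symbolMul {φ : Torus → ℝ} (hφ : MemLp φ ∞ arc) (l : ℝ) (f : L2) (n : ℤ) :
    inner ℂ (mulL (fourierLp ∞ n) f) (symbolMul φ hφ l f) =
      fourierCoeff (fun t => (((φ t - l) * ‖f t‖ ^ 2 : ℝ) : ℂ)) n := by
  rw [L2.inner_def]
  refine integral_congr_ae ?_
  filter_upwards [coeFn_mulL_fourierLp n f, coeFn_symbolMul hφ l f] with t h1 h2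
  have h3 : conj (f t) * f t = ((‖f t‖ ^ 2 : ℝ) : ℂ) := by
    rw [RCLike.conj_mul]
    norm_cast
  rw [h1, h2, RCLike.inner_apply, map_mul, fourier_neg, Complex.ofReal_mul, ← h3, smul_eq_mul]
  ring

theorem integrable_symbol_mul_norm_sq {φ : Torus → ℝ} (hφ : MemLp φ ∞ arc) (l : ℝ) (f : L2) :
    Integrable (fun t => (φ t - l) * ‖f t‖ ^ 2) arc := by
  have h := (L2.integrable_inner (𝕜 := ℂ) f (symbolMul φ hφ l f)).re
  refine h.congr ?_
  filter_upwards [coeFn_symbolMul hφ l f] with t h2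
  have h3 : conj (f t) * f t = ((‖f t‖ ^ 2 : ℝ) : ℂ) := by
    rw [RCLike.conj_mul]
    norm_cast
  rw [h2, RCLike.inner_apply, mul_assoc, mul_comm (f t), h3, ← Complex.ofReal_mul]
  exact Complex.ofReal_re _

/-- A factor χ^{n+2} removes the coefficients of index 0 and 1. This supplies test vectors available
for every W. -/
theorem mulL_add_two_mem_H2V {W : Submodule ℂ L2} (hW : W ≤ linPoly) {k : L2} (hk : k ∈ H2) (n : ℕ) :
    mulL (fourierLp ∞ ((n + 2 : ℕ) : ℤ)) k ∈ H2V W := by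
  refine mem_H2V.2 ⟨mulL_fourierLp_mem_H2 _ hk, fun w hw => ?_⟩
  obtain ⟨a, b, rfl⟩ := mem_linPoly.1 (hW hw)
  rw [inner_linPoly, fourierCoeff_mulL_fourierLp, fourierCoeff_mulL_fourierLp, hk _ (by omega),
    hk _ (by omega), mul_zero, mul_zero, add_zero]

/-- An outer solution of `(φ - l) |f|² = trig c` is an eigenvector. -/
theorem toeplitz_outer_solution {φ : Torus → ℝ} (hφ : MemLp φ ∞ arc) {c : ℂ} {l : ℝ} {f : L2}
    (hf : IsOuter f) (hsol : ∀ᵐ t ∂arc, (φ t - l) * ‖f t‖ ^ 2 = trig c t)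
    (hfV : f ∈ H2V (linPolyPerp f)) :
    toeplitz φ hφ (linPolyPerp f) ⟨f, hfV⟩ = (l : ℂ) • ⟨f, hfV⟩ := by
  rw [toeplitz_eq_smul_iff]
  intro k hk
  obtain ⟨hkH, hkV⟩ := mem_H2V.1 hk
  set D := symbolMul φ hφ l f with hD
  have hshift (n : ℤ) : inner ℂ (mulL (fourierLp ∞ n) f) D =
      (if n = 1 then c else 0) + (if n = -1 then conj c else 0) := by
    rw [hD, inner_mulL_symbolMul, ← fourierCoeff_trig]
    refine congrFun (fourierCoeff_congr_ae ?_) n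
    filter_upwards [hsol] with t ht
    rw [ht]
  set w := H2.starProjection D with hw
  have hwH : w ∈ H2 := Submodule.starProjection_apply_mem _ _
  have hinner {g : L2} (hg : g ∈ H2) : inner ℂ g w = inner ℂ g D := by
    rw [hw, ← Submodule.inner_starProjection_left_eq_right,
      Submodule.starProjection_eq_self_iff.2 hg]
  -- For g = χⁿf this is a Fourier coefficient of τ of index n + 2, hence 0. Outerness of f extends
  -- it to all of H².
  have h2 {g : L2} (hg : g ∈ H2) : inner ℂ (mulL (fourierLp ∞ 2) g) D = 0 := by
    have := map_mem_of_mem_cyclic (Submodule.isClosed_orthogonal (Submodule.span ℂ {D}))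
      (mulL (fourierLp ∞ 2)) (fun n => by
        rw [Submodule.mem_orthogonal_singleton_iff_inner_left, mulL_mulL_fourierLp, hshift,
          if_neg (by omega), if_neg (by omega), add_zero]) (hf.ge hg)
    exact Submodule.mem_orthogonal_singleton_iff_inner_left.1 this
  have hwlin : w = fourierCoeff w 0 • one + fourierCoeff w 1 • chi := by
    apply ext_fourierCoeff
    intro n
    rw [fourierCoeff_add', fourierCoeff_smul', fourierCoeff_smul', one, chi, fourierCoeff_fourierLp,
      fourierCoeff_fourierLp]
    rcases lt_or_ge n 0 with hn | hn
    · rw [hwH n hn, if_neg (by omega), if_neg (by omega)]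
      simp
    · lift n to ℕ using hn
      rcases lt_or_ge n 2 with hn | hn
      · interval_cases n <;> simp
      · obtain ⟨j, rfl⟩ := Nat.exists_eq_add_of_le hn
        have e : (((2 + j : ℕ) : ℤ)) = 2 + (j : ℤ) := by push_cast; rfl
        have := h2 (fourierLp_mem_H2 j)
        rw [← mulL_fourierLp_one, mulL_mulL_fourierLp, mulL_fourierLp_one, ← e,
          ← hinner (fourierLp_mem_H2 _), ← fourierCoeff_eq_inner] at this
        rw [this, if_neg (by omega), if_neg (by omega)]
        simp
  -- The inner product of f with w is the mean of τ, which is 0.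
  have hwV : w ∈ linPolyPerp f := by
    refine mem_linPolyPerp.2 ⟨mem_linPoly.2 ⟨_, _, hwlin.symm⟩, ?_⟩
    rw [inner_eq_zero_symm, hinner hf.mem_H2]
    have := hshift 0
    rwa [mulL_fourierLp_zero, if_neg (by norm_num), if_neg (by norm_num), add_zero] at this
  rw [← hinner hkH, inner_eq_zero_symm]
  exact hkV w hwV

/-- Every eigenvector is a multiple of the outer solution, and lives on a nonzero space. -/
theorem eigenvector_eq_smul {φ : Torus → ℝ} (hφ : MemLp φ ∞ arc) {c : ℂ} (hc : c ≠ 0) {l : ℝ}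
    {f X : L2} (hf : IsOuter f) (hX : IsOuter X) (hf0 : ∀ᵐ t ∂arc, f t ≠ 0)
    (hpos : ∀ᵐ t ∂arc, 0 < (φ t - l) * trig c t)
    (hsol : ∀ᵐ t ∂arc, (φ t - l) * ‖f t‖ ^ 2 = trig c t)
    (hXf : ∀ᵐ t ∂arc, X t = fourier 1 t * ((φ t - l : ℝ) * conj (f t)))
    {W : Submodule ℂ L2} (hW : W ≤ linPoly) {g : H2V W} (hg0 : g ≠ 0)
    (hg : toeplitz φ hφ W g = (l : ℂ) • g) :
    W ≠ ⊥ ∧ ∃ a : ℂ, a ≠ 0 ∧ (g : L2) = a • f := by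
  rw [toeplitz_eq_smul_iff] at hg
  obtain ⟨g, hgW⟩ := g
  have hgH : g ∈ H2 := (mem_H2V.1 hgW).1
  replace hg0 : g ≠ 0 := fun h => hg0 (Subtype.ext h)
  simp only at hg ⊢
  set D := symbolMul φ hφ l g with hD
  set d := fourierCoeff (fun t => (((φ t - l) * ‖g t‖ ^ 2 : ℝ) : ℂ)) 1 with hd
  have htrig : ∀ᵐ t ∂arc, (φ t - l) * ‖g t‖ ^ 2 = trig d t := by
    refine exists_ae_eq_trig (integrable_symbol_mul_norm_sq hφ l g) ?_ fun n hn => ?_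
    · rw [← inner_mulL_symbolMul hφ, mulL_fourierLp_zero]
      exact hg g hgW
    · obtain ⟨j, rfl⟩ := Nat.exists_eq_add_of_le' hn
      rw [← inner_mulL_symbolMul hφ]
      exact hg _ (mulL_add_two_mem_H2V hW hgH j)
  obtain ⟨r, hr, hdr⟩ := exists_nonneg_smul_of_trig_mul_nonneg (d := d) hc (by
    filter_upwards [htrig, hpos] with t h1 h2
    rw [← h1, ← mul_assoc, mul_comm (trig c t)]
    exact mul_nonneg h2.le (sq_nonneg _))
  have hnorm : ∀ᵐ t ∂arc, ‖g t‖ = √r * ‖f t‖ := by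
    filter_upwards [htrig, hsol, hpos] with t h1 h2 h3
    have h4 : trig d t = r * trig c t := by
      rw [hdr, trig, trig, mul_assoc (r : ℂ), Complex.re_ofReal_mul]
      ring
    rw [h4, ← h2, mul_left_comm] at h1
    have h5 := mul_left_cancel₀ (left_ne_zero_of_mul h3.ne') h1
    rw [← sq_eq_sq₀ (norm_nonneg _) (by positivity), mul_pow, Real.sq_sqrt hr, h5]
  have hr0 : r ≠ 0 := by
    rintro rfl
    apply hg0
    apply Lp.ext
    filter_upwards [hnorm, Lp.coeFn_zero ℂ 2 arc] with t h1 h2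
    rw [Real.sqrt_zero, zero_mul, norm_eq_zero] at h1
    rw [h1, h2, Pi.zero_apply]
  have hs : 0 < √r := Real.sqrt_pos.2 (lt_of_le_of_ne hr hr0.symm)
  have hsc : ((√r : ℝ) : ℂ) ≠ 0 := by exact_mod_cast hs.ne'
  refine ⟨?_, ?_⟩
  · rintro rfl
    -- If W = 0, then χg is also a test vector, which would give d = 0.
    have h1 := hg (mulL (fourierLp ∞ ((1 : ℕ) : ℤ)) g)
      (mem_H2V.2 ⟨mulL_fourierLp_mem_H2 1 hgH, by simp⟩)
    rw [Nat.cast_one, inner_mulL_symbolMul hφ, ← hd, hdr] at h1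
    exact mul_ne_zero (by exact_mod_cast hr0) hc h1
  set g₁ : L2 := ((√r : ℝ) : ℂ)⁻¹ • g with hg₁
  have hg₁t : ∀ᵐ t ∂arc, g₁ t = ((√r : ℝ) : ℂ)⁻¹ * g t := by
    filter_upwards [Lp.coeFn_smul ((√r : ℝ) : ℂ)⁻¹ g] with t ht
    rw [hg₁, ht, Pi.smul_apply, smul_eq_mul]
  obtain ⟨u, hu1, hu2, hu3⟩ := exists_unimodular_mul (f := f) (g := g₁) hf0 (by
    filter_upwards [hg₁t, hnorm] with t h1 h2
    rw [h1, norm_mul, h2, norm_inv, Complex.norm_real, Real.norm_of_nonneg hs.le,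
      inv_mul_cancel_left₀ hs.ne'])
  have hDn (n : ℤ) (hn : 2 ≤ n) : fourierCoeff D n = 0 := by
    obtain ⟨j, rfl⟩ : ∃ j : ℕ, n = ((j + 2 : ℕ) : ℤ) := ⟨(n - 2).toNat, by omega⟩
    rw [fourierCoeff_eq_inner, ← mulL_fourierLp_one]
    exact hg _ (mulL_add_two_mem_H2V hW (fourierLp_mem_H2 0) j)
  -- The coefficient of χ conj D at n is the conjugate of that of D at 1 − n. For n < 0 this index
  -- is at least 2, so the right side lies in H².
  have huX : mulL (star u) X = ((√r : ℝ) : ℂ)⁻¹ • mulL (fourierLp ∞ 1) (star D) := by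
    apply Lp.ext
    filter_upwards [coeFn_mulL (star u) X, Lp.coeFn_star u, hXf, hu2, hg₁t,
      Lp.coeFn_smul ((√r : ℝ) : ℂ)⁻¹ (mulL (fourierLp ∞ 1) (star D)),
      coeFn_mulL_fourierLp 1 (star D), Lp.coeFn_star D, coeFn_symbolMul hφ l g]
      with t h1 h2 h3 h4 h5 h6 h7 h8 h9
    have h10 : conj (u t) * conj (f t) = ((√r : ℝ) : ℂ)⁻¹ * conj (g t) := by
      rw [← map_mul, ← h4, h5, map_mul, map_inv₀, Complex.conj_ofReal]
    rw [h1, h2, h3, h6, Pi.smul_apply, h7, h8, Pi.star_apply, Pi.star_apply, hD, h9,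
      RCLike.star_def, map_mul, Complex.conj_ofReal, smul_eq_mul]
    linear_combination (fourier 1 t * ((φ t - l : ℝ) : ℂ)) * h10
  have huXH : mulL (star u) X ∈ H2 := by
    rw [huX]
    refine H2.smul_mem _ fun n hn => ?_
    rw [fourierCoeff_mulL_fourierLp, fourierCoeff_star, hDn _ (by omega), map_zero]
  obtain ⟨a, ha⟩ := ae_eq_const_of_mulL_mem hf hX (hu3 ▸ H2.smul_mem _ hgH) huXH
  refine ⟨((√r : ℝ) : ℂ) * a, mul_ne_zero hsc ?_, ?_⟩
  · obtain ⟨t, h1, h2⟩ := (ha.and hu1).exists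
    rw [← h1]
    exact norm_ne_zero_iff.1 (by rw [h2]; exact one_ne_zero)
  · have : g₁ = a • f := by
      apply Lp.ext
      filter_upwards [ha, hu2, Lp.coeFn_smul a f] with t h1 h2 h3
      rw [h2, h3, h1, Pi.smul_apply, smul_eq_mul]
    rw [mul_smul, ← this, hg₁, smul_inv_smul₀ hsc]

end NeilToeplitz

end

open NeilToeplitz in
theorem corollary3p4
    (φ : NeilToeplitz.Torus → ℝ) (hφ : MemLp φ ∞ NeilToeplitz.arc)
    (c : ℂ) (hc : c ≠ 0) (m M : ℝ)
    (hm : essSup φ (NeilToeplitz.arc.restrict {t | NeilToeplitz.trig c t < 0}) = m)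
    (hm0 : m < 0) (hM0 : 0 < M)
    (hM : essInf φ (NeilToeplitz.arc.restrict {t | 0 < NeilToeplitz.trig c t}) = M)
    (l : ℝ) (hl : l ∈ Set.Ioo m M) :
    -- `h_c` and `g_l` are outer, with nonzero values at `0`
    NeilToeplitz.IsOuterOnDisc (NeilToeplitz.hFun c) ∧
    NeilToeplitz.IsOuterOnDisc (NeilToeplitz.gFun φ l) ∧
    NeilToeplitz.hFun c 0 ≠ 0 ∧ NeilToeplitz.gFun φ l 0 ≠ 0 ∧
    -- the essentially unique outer function `f = f_l`, and its factorization
    ∃ f : NeilToeplitz.L2, NeilToeplitz.IsOuter f ∧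
      (∀ᵐ t ∂NeilToeplitz.arc, (φ t - l) * ‖f t‖ ^ 2 = NeilToeplitz.trig c t) ∧
      (∀ z ∈ Metric.ball (0 : ℂ) 1,
        NeilToeplitz.eval f z = NeilToeplitz.hFun c z * NeilToeplitz.gFun φ l z) ∧
      (∀ f' : NeilToeplitz.L2, NeilToeplitz.IsOuter f' →
        (∀ᵐ t ∂NeilToeplitz.arc, (φ t - l) * ‖f' t‖ ^ 2 = NeilToeplitz.trig c t) →
        ∃ a : ℂ, ‖a‖ = 1 ∧ f' = a • f) ∧
      -- the nontrivial space `V`, orthogonal to the first order part of `h_c g_l`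
      ∃ V : Submodule ℂ NeilToeplitz.L2,
        V ≤ NeilToeplitz.linPoly ∧ V ≠ ⊥ ∧ V ≠ NeilToeplitz.linPoly ∧
        (∀ v ∈ V, inner ℂ v
          ((NeilToeplitz.hFun c 0 * NeilToeplitz.gFun φ l 0) • NeilToeplitz.one +
            (NeilToeplitz.hFun c 0 * deriv (NeilToeplitz.gFun φ l) 0 +
              deriv (NeilToeplitz.hFun c) 0 * NeilToeplitz.gFun φ l 0) •
                NeilToeplitz.chi) = 0) ∧
        -- `f` belongs to `H²_W`, for nonzero `W`, exactly when `W = V`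
        (∀ W : Submodule ℂ NeilToeplitz.L2, W ≤ NeilToeplitz.linPoly → W ≠ ⊥ →
          (f ∈ NeilToeplitz.H2V W ↔ W = V)) ∧
        -- `f` is an eigenvector of the Toeplitz operator on `H²_V` with eigenvalue `l`
        (∀ hf : f ∈ NeilToeplitz.H2V V,
          NeilToeplitz.toeplitz φ hφ V ⟨f, hf⟩ = (l : ℂ) • ⟨f, hf⟩) ∧
        -- every eigenvector for `l`, on any of the spaces, is a multiple of `f`, and lives on `V`
        (∀ W : Submodule ℂ NeilToeplitz.L2, W ≤ NeilToeplitz.linPoly →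
          ∀ f' : NeilToeplitz.H2V W, f' ≠ 0 →
            NeilToeplitz.toeplitz φ hφ W f' = (l : ℂ) • f' →
            W = V ∧ ∃ a : ℂ, a ≠ 0 ∧ (f' : NeilToeplitz.L2) = a • f) := by
  obtain ⟨δ, C, hδ, hψ⟩ := symbol_bounds hφ hc hm hM hl
  obtain ⟨hh, hg, f, X, hf, hX, hf0, hsol, hfac, hXf⟩ := exists_outer_solution hφ.1 hc hδ hψ
  have hh0 : hFun c 0 ≠ 0 := Complex.exp_ne_zero _
  have hg0 : gFun φ l 0 ≠ 0 := Complex.exp_ne_zero _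
  have hball : Metric.ball (0 : ℂ) 1 ∈ nhds (0 : ℂ) := Metric.ball_mem_nhds _ one_pos
  have hcoef0 : hFun c 0 * gFun φ l 0 = fourierCoeff f 0 := by
    rw [← hfac 0 (Metric.mem_ball_self one_pos), eval_zero]
  have hne : fourierCoeff f 0 ≠ 0 := hcoef0 ▸ mul_ne_zero hh0 hg0
  have hcoef1 : hFun c 0 * deriv (gFun φ l) 0 + deriv (hFun c) 0 * gFun φ l 0 =
      fourierCoeff f 1 := by
    have hdiff {F : ℂ → ℂ} (hF : IsOuterOnDisc F) : HasDerivAt F (deriv F 0) 0 := by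
      obtain ⟨k, -, hk⟩ := hF
      exact ((hasDerivAt_eval_zero k).congr_of_eventuallyEq
        (Filter.eventually_of_mem hball hk)).differentiableAt.hasDerivAt
    have h1 := (hasDerivAt_eval_zero f).congr_of_eventuallyEq
      (Filter.eventually_of_mem hball fun z hz => (hfac z hz).symm)
    -- The product rule for h_c g_λ, which coincides with the extension of f near 0.
    rw [h1.unique ((hdiff hh).mul (hdiff hg)), add_comm]
  have hiff : ∀ W : Submodule ℂ L2, W ≤ linPoly → W ≠ ⊥ → (f ∈ H2V W ↔ W = linPolyPerp f) := by
    intro W hW hW0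
    refine ⟨fun h => eq_linPolyPerp hne hW hW0 (mem_H2V.1 h).2, ?_⟩
    rintro rfl
    exact mem_H2V.2 ⟨hf.mem_H2, fun w hw => (mem_linPolyPerp.1 hw).2⟩
  refine ⟨hh, hg, hh0, hg0, f, hf, hsol, hfac, fun f' hf' hsol' => ?_, linPolyPerp f, inf_le_left,
    linPolyPerp_ne_bot hne, linPolyPerp_ne_linPoly hne, fun v hv => ?_, hiff,
    fun hfV => toeplitz_outer_solution hφ hf hsol hfV, fun W hW f' hf'0 hf' => ?_⟩
  · refine hf.eq_smul_of_norm_eq hf' hf0 ?_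
    filter_upwards [hsol, hsol', hψ] with t h1 h2 h3
    rw [← h1] at h2
    exact (sq_eq_sq₀ (norm_nonneg _) (norm_nonneg _)).1
      (mul_left_cancel₀ (left_ne_zero_of_mul h3.2.2.ne') h2)
  · obtain ⟨hv1, hv2⟩ := mem_linPolyPerp.1 hv
    obtain ⟨a, b, rfl⟩ := mem_linPoly.1 hv1
    -- A vector of ℂ ⊕ ℂz sees only the first two coefficients, so orthogonality to f is
    -- orthogonality to its first-order part.
    rw [hcoef0, hcoef1, ← hv2, inner_linPoly, inner_linPoly]
    simp only [fourierCoeff_add', fourierCoeff_smul', one, chi, fourierCoeff_fourierLp]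
    norm_num
  · obtain ⟨hW0, a, ha, hfa⟩ := eigenvector_eq_smul hφ hc hf hX hf0 (hψ.mono fun t h => h.2.2) hsol
      hXf hW hf'0 hf'
    refine ⟨(hiff W hW hW0).1 ?_, a, ha, hfa⟩
    have h := (H2V W).smul_mem a⁻¹ f'.2
    rwa [hfa, inv_smul_smul₀ ha] at h
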